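/- Let $X=(S^1\times\{1\})\cup(\{1\}\times S^1)\subset S^1\times S^1$ be the wedge of two circles with base point $x_0=(1,1)$, and let $a,b$ be the loops at $x_0$ running once around the first and the second circle. Let $Y=\{(z,w)\in S^1\times S^1 : z^2=1 \text{ or } w^2=1\}$ and $p:Y\to X$, $p(z,w)=(z^2,w^2)$. Then the following hold. 1. $\pi_1(X,x_0)$ is free of rank $2$ with basis $a,b$. 2. $p$ is the mod-2 homology cover of $X$: it is a surjective covering map with finite fibres, $Y$ is path connected, the deck transformations act transitively on each fibre, and for every $y\in Y$ a loop in $X$ based at $p(y)$ lifts to a loop in $Y$ based at $y$ if and only if its class in $H_1(X;\mathbb Z/2)$ is zero. 3. Every automorphism of $\pi_1(X,x_0)\cong F_2$ sends $[a,b]=aba^{-1}b^{-1}$ to a conjugate of $[a,b]$ or of $[a,b]^{-1}$. 4. At every point $y\in p^{-1}(x_0)$ the loop $aba^{-1}b^{-1}$ lifts to a loop in $Y$ based at $y$. Let $v\in H_1(Y;\mathbb Q)$ be the class of any such lift. Then $v\neq 0$, and the set $$\{\,\widetilde F_*(v) \;:\; F:X\to X \text{ a homotopy equivalence},\ \widetilde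 F:Y\to Y \text{ continuous with } p\circ\widetilde F=F\circ p\,\}\subset H_1(Y;\mathbb Q)$$ is finite. Moreover, for every such lift $\widetilde F$ the induced map $\widetilde F_*$ on $H_1(Y;\mathbb Q)$ is invertible and the set $\{\widetilde F_*^{\,d}(v): d\in\mathbb Z\}$ is finite. In particular, the following theorem, valid for finite normal covers of wedges of $n\ge 3$ circles, fails for $n=2$: for every $0\ne v\in H_1(Y;\mathbb Q)$ there is a lift $\widetilde F$ of a homotopy equivalence of the wedge such that $\{\widetilde F_*^{\,d}(v):d\in\mathbb Z\}$ is infinite. -/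

import Mathlib

open CategoryTheory AlgebraicTopology
open scoped Simplicial ContinuousMap

noncomputable section

namespace RankTwo

/-! ### First singular homology and the class of a loop -/

/-- The first singular homology `H₁(Y; R)` of a topological space. -/
abbrev H1 (R : Type) [CommRing R] (Y : Type) [TopologicalSpace Y] : ModuleCat.{0} R :=
  ((singularHomologyFunctor (ModuleCat.{0} R) 1).obj (ModuleCat.of R R)).obj (TopCat.of Y)

/-- The map `f_* : H₁(Y; R) → H₁(Z; R)` induced by a continuous map `f`. -/
def H1map (R : Type) [CommRing R] {Y Z : Type} [TopologicalSpace Y] [TopologicalSpace Z]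
    (f : C(Y, Z)) : H1 R Y →ₗ[R] H1 R Z :=
  (((singularHomologyFunctor (ModuleCat.{0} R) 1).obj (ModuleCat.of R R)).map
    (TopCat.ofHom f)).hom

/-- A path, regarded as a singular `1`-simplex. -/
def pathSimplex {Y : Type} [TopologicalSpace Y] {y z : Y} (γ : Path y z) :
    (TopCat.toSSet.obj (TopCat.of Y)) _⦋1⦌ :=
  (TopCat.toSSetObj₁Equiv (X := TopCat.of Y)).symm
    (TopCat.pathEquiv (X := TopCat.of Y).symm γ).hom

/-- The singular `1`-simplex of a loop is a cycle. -/
theorem pathSimplex_cycle (R : Type) [CommRing R] {Y : Type} [TopologicalSpace Y] {y : Y}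
    (γ : Path y y) :
    (TopCat.toSSet.obj (TopCat.of Y)).ιChainComplex (R := ModuleCat.of R R) (pathSimplex γ) ≫
      ((TopCat.toSSet.obj (TopCat.of Y)).chainComplex (ModuleCat.of R R)).d 1 0 = 0 := by
  have h : (TopCat.pathEquiv (X := TopCat.of Y).symm γ).hom 1 =
      (TopCat.pathEquiv (X := TopCat.of Y).symm γ).hom 0 :=
    (TopCat.pathEquiv (X := TopCat.of Y).symm γ).hom₁.trans
      (TopCat.pathEquiv (X := TopCat.of Y).symm γ).hom₀.symm
  rw [SSet.ιChainComplex_d]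
  have h' : (TopCat.toSSet.obj (TopCat.of Y)).δ 0 (pathSimplex γ) =
      (TopCat.toSSet.obj (TopCat.of Y)).δ 1 (pathSimplex γ) := by
    rw [pathSimplex, TopCat.δ_zero_toSSetObj₁Equiv.symm, TopCat.δ_one_toSSetObj₁Equiv.symm, h]
  refine (Fin.sum_univ_two _).trans ?_
  rw [h']
  simp

/-- The class `[γ] ∈ H₁(Y; R)` of a loop `γ`: the homology class of the singular `1`-cycle `1 · γ`.
The two factors are the map `R → Z₁`, `r ↦ r · γ`, and the projection `Z₁ → H₁`. -/
def loopClass (R : Type) [CommRing R] {Y : Type} [TopologicalSpace Y] {y : Y}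
    (γ : Path y y) : H1 R Y :=
  (((TopCat.toSSet.obj (TopCat.of Y)).chainComplex (ModuleCat.of R R)).liftCycles
      ((TopCat.toSSet.obj (TopCat.of Y)).ιChainComplex (pathSimplex γ)) 0 (by simp)
      (pathSimplex_cycle R γ) ≫
    ((TopCat.toSSet.obj (TopCat.of Y)).chainComplex (ModuleCat.of R R)).homologyπ 1).hom (1 : R)

/-! ### Covers and lifts -/

/-- `p : Y → X` is a finite regular (normal) connected cover: a covering map from a path connected
space, with finite fibres, on each of which the deck transformations act transitively. -/
structure IsFiniteRegularCover {Y X : Type} [TopologicalSpace Y] [TopologicalSpace X]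
    (p : C(Y, X)) : Prop where
  isCoveringMap : IsCoveringMap p
  surjective : Function.Surjective p
  pathConnected : PathConnectedSpace Y
  finite_fibre : ∀ x : X, (p ⁻¹' {x}).Finite
  regular : ∀ y y' : Y, p y = p y' → ∃ h : Y ≃ₜ Y, (∀ z, p (h z) = p z) ∧ h y = y'

/-- `p : Y → X` is the mod-2 homology cover: the connected cover corresponding to the kernel of
`π₁(X) → H₁(X; ℤ/2)`, i.e. a loop in `X` lifts to a loop in `Y` if and only if its class in
`H₁(X; ℤ/2)` vanishes. -/
structure IsModTwoHomologyCover {Y X : Type} [TopologicalSpace Y] [TopologicalSpace X]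
    (p : C(Y, X)) : Prop extends IsFiniteRegularCover p where
  lifts_iff : ∀ (y : Y) (γ : Path (p y) (p y)),
    (∃ δ : Path y y, ∀ t, p (δ t) = γ t) ↔ loopClass (ZMod 2) γ = 0

/-- `G : Y → Y` is a lift of `F : X → X` through `p : Y → X`. No base points are fixed. -/
def IsLift {Y X : Type} [TopologicalSpace Y] [TopologicalSpace X]
    (p : C(Y, X)) (F : C(X, X)) (G : C(Y, Y)) : Prop :=
  ∀ z, p (G z) = F (p z)

/-- The set of all images `G_*(v) ∈ H₁(Y; ℚ)`, where `G` runs over all lifts to `Y` of all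
self homotopy equivalences of `X`. -/
def liftOrbit {Y X : Type} [TopologicalSpace Y] [TopologicalSpace X]
    (p : C(Y, X)) (v : H1 ℚ Y) : Set (H1 ℚ Y) :=
  {w | ∃ (F : X ≃ₕ X) (G : C(Y, Y)), IsLift p F.toFun G ∧ H1map ℚ G v = w}

/-! ### The wedge of two circles and its mod-2 homology cover -/

/-- The wedge of two circles `S¹ × {1} ∪ {1} × S¹`, joined at the point `(1, 1)`. -/
abbrev Wedge : Type := {q : Circle × Circle // q.1 = 1 ∨ q.2 = 1}

/-- The point at which the two circles are joined. -/
def base : Wedge := ⟨(1, 1), Or.inl rfl⟩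

/-- The loop `a`, running once around the first circle. -/
def loopA : Path base base where
  toFun t := ⟨(Circle.exp (2 * Real.pi * t), 1), Or.inr rfl⟩
  continuous_toFun := by fun_prop
  source' := by simp [base]
  target' := by simp [base]

/-- The loop `b`, running once around the second circle. -/
def loopB : Path base base where
  toFun t := ⟨(1, Circle.exp (2 * Real.pi * t)), Or.inl rfl⟩
  continuous_toFun := by fun_prop
  source' := by simp [base]
  target' := by simp [base]

/-- The commutator loop `[a, b] = a b a⁻¹ b⁻¹`. -/
def commLoop : Path base base :=
  ((loopA.trans loopB).trans loopA.symm).trans loopB.symm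

/-- The element of `π₁(Wedge, base)` represented by a loop. -/
abbrev cls (γ : Path base base) : FundamentalGroup Wedge base :=
  FundamentalGroup.fromPath (Path.Homotopic.Quotient.mk γ)

/-- The preimage of the wedge under the squaring map of the torus `S¹ × S¹`: a graph with the four
vertices `(±1, ±1)`. -/
abbrev Cover : Type := {q : Circle × Circle // q.1 ^ 2 = 1 ∨ q.2 ^ 2 = 1}

/-- The covering map `(z, w) ↦ (z², w²)`. -/
def proj : C(Cover, Wedge) where
  toFun q := ⟨(q.1.1 ^ 2, q.1.2 ^ 2), q.2⟩
  continuous_toFun := by fun_prop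

end RankTwo

end

/-! In rank two the commutator is rigid: every automorphism of `F₂` preserves it up to conjugation
and inversion. Hence a homotopy equivalence of the wedge carries the commutator loop, up to a change
of base point, to itself or to its reverse (`exists_conj_map_commLoop`). Lifting this homotopy, a
map `G` of the cover carries each lift of the commutator to a loop freely homotopic to another lift
or to the reverse of one. There are only finitely many lifts, so their classes and the negatives of
these form a finite set `commClasses`, stable under all such `G` (`H1map_mem_commClasses`). This
bounds the orbit, and also all iterates once `H1map ℚ G` is known to be invertible.

Rigidity (`isConjOrInv_thetaCommutator`) is proved by Stallings folding. A generating pair is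
encoded as a theta graph whose three edges carry words `p`, `q`, `r`; folding at a vertex lowers the
total length and only conjugates the commutator. A theta graph that admits no fold cannot generate,
because its even edge paths never have length one. When an edge degenerates the graph is a rose, and
an unfoldable rose that generates carries the standard generators up to order and sign.

Freeness of `π₁` has two halves: subdivision of paths gives generation (`isWord`), and an explicit
covering whose monodromy is left multiplication gives injectivity (`monodromy_wedgeHom`). The mod-2
property compares parities of winding numbers on both sides: they decide whether a loop lifts
(`even_windings_iff`) and whether its class vanishes (`loopClass_zmod_two_eq_zero_iff`).
Invertibility is surjectivity (`H1map_surjective_of_isLift`) on a finite-dimensional space.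
Nonvanishing is detected by `edgeMap`, under which one lift of the commutator has winding number
one. -/

open CategoryTheory AlgebraicTopology
open scoped Simplicial ContinuousMap

noncomputable section

namespace RankTwo

/-! ### First homology and loops -/

section Singular

variable {Y : Type} [TopologicalSpace Y]

/-- The edge of the standard 2-simplex opposite to the vertex `i`. -/
def simplexEdge (i : Fin 3) : Path (X := stdSimplex ℝ (Fin 3))
    (stdSimplex.vertex (i.succAbove 0)) (stdSimplex.vertex (i.succAbove 1)) where
  toFun t := stdSimplex.map i.succAbove (stdSimplexHomeomorphUnitInterval.symm t)
  continuous_toFun := (stdSimplex.continuous_map _).comp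
    stdSimplexHomeomorphUnitInterval.symm.continuous
  source' := by
    rw [← stdSimplexHomeomorphUnitInterval_zero, Homeomorph.symm_apply_apply]
    exact stdSimplex.map_vertex _ _
  target' := by
    rw [← stdSimplexHomeomorphUnitInterval_one, Homeomorph.symm_apply_apply]
    exact stdSimplex.map_vertex _ _

/-- The singular `2`-simplex given by a continuous map on the standard simplex. -/
def twoSimplex (τ : C(stdSimplex ℝ (Fin 3), Y)) : (TopCat.toSSet.obj (TopCat.of Y)) _⦋2⦌ :=
  (TopCat.toSSetObjEquiv (TopCat.of Y) _).symm τ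

theorem twoSimplex_surjective : Function.Surjective (twoSimplex (Y := Y)) :=
  (TopCat.toSSetObjEquiv (TopCat.of Y) _).symm.surjective

theorem δ_twoSimplex (τ : C(stdSimplex ℝ (Fin 3), Y)) (i : Fin 3) :
    (TopCat.toSSet.obj (TopCat.of Y)).δ i (twoSimplex τ) =
      pathSimplex ((simplexEdge i).map τ.continuous) := by
  apply (TopCat.toSSetObjEquiv (TopCat.of Y) _).injective
  ext s
  obtain ⟨t, rfl⟩ := stdSimplexHomeomorphUnitInterval.symm.surjective s
  trans τ (simplexEdge i t)
  · rfl
  · have : t = stdSimplexHomeomorphUnitInterval (stdSimplexHomeomorphUnitInterval.symm t) := by simp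
    conv_lhs => rw [this]
    rfl

theorem exists_pathSimplex (s : (TopCat.toSSet.obj (TopCat.of Y)) _⦋1⦌) :
    ∃ (x y : Y) (γ : Path x y), s = pathSimplex γ := by
  refine ⟨_, _, TopCat.pathEquiv (X := TopCat.of Y) ⟨TopCat.toSSetObj₁Equiv s, rfl, rfl⟩, ?_⟩
  simp [pathSimplex]

/-! ### Paths as 1-chains modulo boundaries -/

variable (R : Type) [CommRing R]

/-- The singular chain complex. -/
abbrev chains (Y : Type) [TopologicalSpace Y] : ChainComplex (ModuleCat.{0} R) ℕ :=
  (TopCat.toSSet.obj (TopCat.of Y)).chainComplex (ModuleCat.of R R)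

/-- The class of a path in the module of singular 1-chains modulo boundaries. -/
def pathClass {x y : Y} (γ : Path x y) : (chains R Y).opcycles 1 :=
  ((TopCat.toSSet.obj (TopCat.of Y)).ιChainComplex (R := ModuleCat.of R R) (pathSimplex γ) ≫
    (chains R Y).pOpcycles 1).hom (1 : R)

/-- The boundary of a singular 2-simplex vanishes in the opcycles. Homotopy invariance and
additivity of `pathClass` both rest on this relation. -/
theorem pathClass_edges (τ : C(stdSimplex ℝ (Fin 3), Y)) :
    pathClass R ((simplexEdge 2).map τ.continuous) + pathClass R ((simplexEdge 0).map τ.continuous) =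
      pathClass R ((simplexEdge 1).map τ.continuous) := by
  have h := (TopCat.toSSet.obj (TopCat.of Y)).ιChainComplex_d (R := ModuleCat.of R R) (twoSimplex τ)
  have h2 := congrArg (fun f => (f ≫ (chains R Y).pOpcycles 1).hom (1 : R)) h
  simp only [Category.assoc, HomologicalComplex.d_pOpcycles, δ_twoSimplex,
    Limits.comp_zero] at h2
  simp only [Preadditive.sum_comp, Preadditive.zsmul_comp, ModuleCat.hom_sum, ModuleCat.hom_smul,
    LinearMap.sum_apply, LinearMap.smul_apply, ModuleCat.hom_zero, LinearMap.zero_apply] at h2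
  replace h2 := h2.trans (Fin.sum_univ_three _)
  simp only [Fin.val_zero, Fin.val_one, Fin.val_two, pow_zero, pow_one, one_smul, neg_smul,
    even_two, Even.neg_pow, one_pow] at h2
  simp only [pathClass]
  rw [eq_comm, ← sub_eq_zero, ← sub_eq_zero.2 h2]
  abel

/-- The class of a loop, as an element of the homology of the singular chain complex. -/
def loopHomologyClass {y : Y} (γ : Path y y) : (chains R Y).homology 1 := loopClass R γ

theorem homologyι_loopHomologyClass {y : Y} (γ : Path y y) :
    ((chains R Y).homologyι 1).hom (loopHomologyClass R γ) = pathClass R γ := by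
  rw [loopHomologyClass, loopClass, pathClass, ← LinearMap.comp_apply, ← ModuleCat.hom_comp,
    Category.assoc, HomologicalComplex.homology_π_ι, HomologicalComplex.liftCycles_i_assoc]

/-- Homology embeds in chains modulo boundaries, so identities between loop classes can be checked
there, where paths that do not close up also have a class. -/
theorem homologyι_injective : Function.Injective ((chains R Y).homologyι 1).hom :=
  (ModuleCat.mono_iff_injective _).1 inferInstance

theorem simplexEdge_apply (i : Fin 3) (t : unitInterval) (j : Fin 3) :
    (simplexEdge i t : Fin 3 → ℝ) j = (if i.succAbove 0 = j then 1 - (t : ℝ) else 0) +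
      if i.succAbove 1 = j then (t : ℝ) else 0 := by
  change (stdSimplex.map i.succAbove (stdSimplexHomeomorphUnitInterval.symm t) : Fin 3 → ℝ) j = _
  rw [stdSimplex.map_coe, FunOnFinite.linearMap_apply_apply, Finset.sum_filter, Fin.sum_univ_two]
  rfl

theorem pathClass_congr {x y x' y' : Y} {γ : Path x y} {γ' : Path x' y'} (h : ∀ t, γ t = γ' t) :
    pathClass R γ = pathClass R γ' := by
  obtain rfl : x = x' := by simpa using h 0
  obtain rfl : y = y' := by simpa using h 1
  rw [show γ = γ' from Path.ext (funext h)]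

/-- The lower triangle of the unit square, parametrized by the standard simplex. -/
def lowerTriangle : C(stdSimplex ℝ (Fin 3), unitInterval × unitInterval) where
  toFun u := (⟨u.1 1 + u.1 2, add_nonneg (u.2.1 1) (u.2.1 2), by
      have := u.2.2; rw [Fin.sum_univ_three] at this; linarith [u.2.1 0]⟩,
    ⟨u.1 2, u.2.1 2, by
      have := u.2.2; rw [Fin.sum_univ_three] at this; linarith [u.2.1 0, u.2.1 1]⟩)
  continuous_toFun := by
    have h : ∀ i, Continuous fun u : stdSimplex ℝ (Fin 3) => u.1 i := fun i =>
      (continuous_apply i).comp continuous_subtype_val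
    exact (Continuous.subtype_mk ((h 1).add (h 2)) _).prodMk (Continuous.subtype_mk (h 2) _)

/-- `lowerTriangle` sends the vertices to `(0, 0)`, `(1, 0)`, `(1, 1)`, so the faces of the
resulting simplex are the bottom side, the right side and the diagonal. -/
theorem pathClass_triangle (H : C(unitInterval × unitInterval, Y)) {x y z : Y}
    (α : Path x y) (β : Path y z) (δ : Path x z) (hα : ∀ t, H (t, 0) = α t)
    (hβ : ∀ t, H (1, t) = β t) (hδ : ∀ t, H (t, t) = δ t) :
    pathClass R α + pathClass R β = pathClass R δ := by
  have h := pathClass_edges R (H.comp lowerTriangle)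
  have e (i : Fin 3) (t : unitInterval) (c : unitInterval × unitInterval)
      (h1 : (simplexEdge i t : Fin 3 → ℝ) 1 + (simplexEdge i t : Fin 3 → ℝ) 2 = c.1)
      (h2 : (simplexEdge i t : Fin 3 → ℝ) 2 = c.2) :
      (simplexEdge i).map (H.comp lowerTriangle).continuous t = H c :=
    congrArg H (Prod.ext (Subtype.ext h1) (Subtype.ext h2))
  rwa [pathClass_congr R (γ' := α), pathClass_congr R (γ := (simplexEdge 0).map _) (γ' := β),
    pathClass_congr R (γ := (simplexEdge 1).map _) (γ' := δ)] at h
  · exact fun t => (e 1 t (t, t) (by rw [simplexEdge_apply, simplexEdge_apply]; simp [Fin.succAbove])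
      (by rw [simplexEdge_apply]; simp [Fin.succAbove])).trans (hδ t)
  · exact fun t => (e 0 t (1, t) (by rw [simplexEdge_apply, simplexEdge_apply]; simp [Fin.succAbove])
      (by rw [simplexEdge_apply]; simp [Fin.succAbove])).trans (hβ t)
  · exact fun t => (e 2 t (t, 0) (by rw [simplexEdge_apply, simplexEdge_apply]; simp [Fin.succAbove])
      (by rw [simplexEdge_apply]; simp [Fin.succAbove])).trans (hα t)

/-- The boundary of a singular square is a boundary. -/
theorem pathClass_square (H : C(unitInterval × unitInterval, Y)) {x y z w : Y}
    (α : Path x y) (β : Path y w) (δ : Path x z) (ε : Path z w) (hα : ∀ t, H (t, 0) = α t)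
    (hβ : ∀ t, H (1, t) = β t) (hδ : ∀ t, H (0, t) = δ t) (hε : ∀ t, H (t, 1) = ε t) :
    pathClass R α + pathClass R β = pathClass R δ + pathClass R ε := by
  have hx : x = H (0, 0) := by simp [hα]
  have hw : w = H (1, 1) := by simp [hε]
  -- The diagonal cuts the square into two triangles; swapping the coordinates turns the upper one
  -- into the lower one.
  let d : Path x w := ⟨⟨fun t => H (t, t), by fun_prop⟩, hx.symm, hw.symm⟩
  rw [pathClass_triangle R H α β d hα hβ fun _ => rfl,
    pathClass_triangle R (H.comp ⟨Prod.swap, continuous_swap⟩) δ ε d hδ hε fun _ => rfl]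

@[simp]
theorem pathClass_refl (x : Y) : pathClass R (Path.refl x) = 0 := by
  simpa using pathClass_triangle R (.const _ x) (.refl x) (.refl x) (.refl x)
    (fun _ => rfl) (fun _ => rfl) (fun _ => rfl)

theorem pathClass_eq_of_homotopic {x y : Y} {γ γ' : Path x y} (h : γ.Homotopic γ') :
    pathClass R γ = pathClass R γ' := by
  obtain ⟨H⟩ := h
  simpa using (pathClass_square R H.toContinuousMap (.refl x) γ' γ (.refl y)
    (fun t => by simp) (fun t => by simp) (fun t => by simp) (fun t => by simp)).symm

theorem pathClass_trans {x y z : Y} (γ : Path x y) (γ' : Path y z) :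
    pathClass R (γ.trans γ') = pathClass R γ + pathClass R γ' := by
  -- The map `(s, t) ↦ s(1 + t)/2` makes the bottom side run through `γ`, the right side through
  -- `γ'`, the top side through the concatenation, and the left side stay constant.
  let u : C(unitInterval × unitInterval, unitInterval) :=
    ⟨fun p => ⟨p.1 * (1 + p.2) / 2, by
      have := p.1.2.1; have := p.2.2.1; positivity, by
      nlinarith [p.1.2.1, p.1.2.2, p.2.2.1, p.2.2.2]⟩, by fun_prop⟩
  have h := pathClass_square R ((γ.trans γ').toContinuousMap.comp u) γ γ' (.refl x) (γ.trans γ')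
    (fun t => ?_) (fun t => ?_) (fun t => ?_) (fun t => ?_)
  · simpa using h.symm
  · have : u (t, 0) = ⟨t / 2, by linarith [t.2.1], by linarith [t.2.2]⟩ := by simp [u]
    simp only [ContinuousMap.comp_apply, this]
    change (γ.trans γ') _ = _
    rw [Path.trans_apply, dif_pos (by simpa using by linarith [t.2.2])]
    congr 1
    ext; simp; ring
  · have : u (1, t) = ⟨(1 + t) / 2, by linarith [t.2.1], by linarith [t.2.2]⟩ := by simp [u]
    simp only [ContinuousMap.comp_apply, this]
    change (γ.trans γ') _ = _
    rcases eq_or_lt_of_le t.2.1 with h0 | h0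
    · obtain rfl : t = 0 := Subtype.ext h0.symm
      rw [Path.trans_apply, dif_pos (by simp)]
      simp
    · rw [Path.trans_apply, dif_neg (by simp only [not_le]; linarith)]
      congr 1
      ext; simp; ring
  · have : u (0, t) = 0 := by ext; simp [u]
    simp [this]
  · have : u (t, 1) = t := by ext; simp [u]; ring
    simp [this]

theorem pathClass_symm {x y : Y} (γ : Path x y) : pathClass R γ.symm = - pathClass R γ := by
  have h := pathClass_eq_of_homotopic R (Path.Homotopic.trans_symm γ)
  rw [pathClass_trans, pathClass_refl] at h
  exact (neg_eq_of_add_eq_zero_right h).symm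

theorem loopClass_eq_of_pathClass_eq {x y : Y} {γ : Path x x} {γ' : Path y y}
    (h : pathClass R γ = pathClass R γ') : loopClass R γ = loopClass R γ' :=
  homologyι_injective R (by
    rw [← homologyι_loopHomologyClass, ← homologyι_loopHomologyClass] at h; exact h)

theorem opcyclesMap_pathClass {Z : Type} [TopologicalSpace Z] (f : C(Y, Z)) {x y : Y}
    (γ : Path x y) :
    (HomologicalComplex.opcyclesMap (SSet.chainComplexMap (TopCat.toSSet.map (TopCat.ofHom f))
      (ModuleCat.of R R)) 1).hom (pathClass R γ) = pathClass R (γ.map f.continuous) := by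
  rw [pathClass, pathClass, ← LinearMap.comp_apply, ← ModuleCat.hom_comp, Category.assoc,
    HomologicalComplex.p_opcyclesMap, SSet.ι_chainComplexMap_f_assoc]
  rfl

theorem H1map_loopClass {Z : Type} [TopologicalSpace Z] (f : C(Y, Z)) {y : Y} (γ : Path y y) :
    H1map R f (loopClass R γ) = loopClass R (γ.map f.continuous) := by
  have h := HomologicalComplex.homologyι_naturality
    (SSet.chainComplexMap (TopCat.toSSet.map (TopCat.ofHom f)) (ModuleCat.of R R)) 1
  have h2 := LinearMap.congr_fun (congrArg ModuleCat.Hom.hom h) (loopHomologyClass R γ)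
  rw [ModuleCat.hom_comp, ModuleCat.hom_comp, LinearMap.comp_apply, LinearMap.comp_apply,
    homologyι_loopHomologyClass, opcyclesMap_pathClass, ← homologyι_loopHomologyClass] at h2
  exact homologyι_injective R h2

/-! ### Linear maps out of chains, and generation of `H₁` by loops -/

/-- The linear map on singular `1`-chains with given values on the simplices. -/
def chainsDesc {A : ModuleCat.{0} R} (n : ℕ) (f : (TopCat.toSSet.obj (TopCat.of Y)) _⦋n⦌ → A) :
    (chains R Y).X n ⟶ A :=
  Limits.Sigma.desc fun s => ModuleCat.ofHom (LinearMap.toSpanSingleton R A (f s))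

theorem ι_chainsDesc {A : ModuleCat.{0} R} {n : ℕ}
    (f : (TopCat.toSSet.obj (TopCat.of Y)) _⦋n⦌ → A) (s) :
    (TopCat.toSSet.obj (TopCat.of Y)).ιChainComplex (R := ModuleCat.of R R) s ≫ chainsDesc R n f =
      ModuleCat.ofHom (LinearMap.toSpanSingleton R A (f s)) :=
  Limits.Sigma.ι_desc _ _

theorem ι_chainsDesc_apply {A : ModuleCat.{0} R} {n : ℕ}
    (f : (TopCat.toSSet.obj (TopCat.of Y)) _⦋n⦌ → A) (s) :
    (chainsDesc R n f).hom (((TopCat.toSSet.obj (TopCat.of Y)).ιChainComplex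
      (R := ModuleCat.of R R) s).hom (1 : R)) = f s := by
  rw [← LinearMap.comp_apply, ← ModuleCat.hom_comp, ι_chainsDesc]
  simp

theorem chains_hom_ext {A : ModuleCat.{0} R} {n : ℕ} {f g : (chains R Y).X n ⟶ A}
    (h : ∀ s, f.hom (((TopCat.toSSet.obj (TopCat.of Y)).ιChainComplex
      (R := ModuleCat.of R R) s).hom (1 : R)) = g.hom (((TopCat.toSSet.obj
      (TopCat.of Y)).ιChainComplex (R := ModuleCat.of R R) s).hom (1 : R))) : f = g := by
  refine SSet.chainComplex_hom_ext fun s => ?_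
  ext
  exact h s

theorem submodule_chains_eq_top {n : ℕ} (S : Submodule R ((chains R Y).X n))
    (h : ∀ s, ((TopCat.toSSet.obj (TopCat.of Y)).ιChainComplex
      (R := ModuleCat.of R R) s).hom (1 : R) ∈ S) : S = ⊤ := by
  have : ModuleCat.ofHom S.mkQ = 0 :=
    chains_hom_ext R fun s => (Submodule.Quotient.mk_eq_zero S).2 (h s)
  rw [← Submodule.ker_mkQ S, ← ModuleCat.hom_ofHom S.mkQ, this]
  exact LinearMap.ker_zero

theorem δ_zero_pathSimplex {x y : Y} (γ : Path x y) :
    (TopCat.toSSet.obj (TopCat.of Y)).δ 0 (pathSimplex γ) =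
      (TopCat.toSSetObj₀Equiv (X := TopCat.of Y)).symm y := by
  rw [pathSimplex, TopCat.δ_zero_toSSetObj₁Equiv.symm]
  exact congrArg _ (TopCat.pathEquiv (X := TopCat.of Y).symm γ).hom₁

theorem δ_one_pathSimplex {x y : Y} (γ : Path x y) :
    (TopCat.toSSet.obj (TopCat.of Y)).δ 1 (pathSimplex γ) =
      (TopCat.toSSetObj₀Equiv (X := TopCat.of Y)).symm x := by
  rw [pathSimplex, TopCat.δ_one_toSSetObj₁Equiv.symm]
  exact congrArg _ (TopCat.pathEquiv (X := TopCat.of Y).symm γ).hom₀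

theorem d_pathSimplex {x y : Y} (γ : Path x y) :
    ((chains R Y).d 1 0).hom (((TopCat.toSSet.obj (TopCat.of Y)).ιChainComplex
      (R := ModuleCat.of R R) (pathSimplex γ)).hom (1 : R)) =
    ((TopCat.toSSet.obj (TopCat.of Y)).ιChainComplex (R := ModuleCat.of R R)
      ((TopCat.toSSetObj₀Equiv (X := TopCat.of Y)).symm y)).hom (1 : R) -
    ((TopCat.toSSet.obj (TopCat.of Y)).ιChainComplex (R := ModuleCat.of R R)
      ((TopCat.toSSetObj₀Equiv (X := TopCat.of Y)).symm x)).hom (1 : R) := by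
  rw [← LinearMap.comp_apply, ← ModuleCat.hom_comp, SSet.ιChainComplex_d]
  simp only [ModuleCat.hom_sum, ModuleCat.hom_smul, LinearMap.sum_apply, LinearMap.smul_apply]
  refine (Fin.sum_univ_two _).trans ?_
  rw [δ_zero_pathSimplex, δ_one_pathSimplex]
  simp [sub_eq_add_neg]

theorem eq_of_pathSimplex_eq {x y x' y' : Y} {γ : Path x y} {γ' : Path x' y'}
    (h : pathSimplex γ = pathSimplex γ') (t : unitInterval) : γ t = γ' t := by
  have h' := (TopCat.toSSetObj₁Equiv (X := TopCat.of Y)).symm.injective h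
  exact congrArg (fun f : TopCat.I ⟶ TopCat.of Y => f (ULift.up t)) h'

/-- Close each singular edge to a loop at `y` by chosen paths `c`. The resulting map `L` on 1-chains
differs from the projection to opcycles by a term that factors through `d`. On cycles this term
vanishes, so `L` there computes the homology class, which thus lies in the span of loops. -/
theorem span_loopHomologyClass [PathConnectedSpace Y] (y : Y) :
    Submodule.span R (Set.range fun γ : Path y y => loopHomologyClass R γ) = ⊤ := by
  let c (x : Y) : Path y x := PathConnectedSpace.somePath y x
  choose x₀ x₁ γ hγ using exists_pathSimplex (Y := Y)
  let l (s) : (chains R Y).homology 1 :=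
    loopHomologyClass R (((c (x₀ s)).trans (γ s)).trans (c (x₁ s)).symm)
  let L : (chains R Y).X 1 ⟶ (chains R Y).homology 1 := chainsDesc R 1 l
  let K : (chains R Y).X 0 ⟶ (chains R Y).opcycles 1 :=
    chainsDesc R 0 fun s => pathClass R (c (TopCat.toSSetObj₀Equiv s))
  have h : L ≫ (chains R Y).homologyι 1 =
      (chains R Y).pOpcycles 1 - (chains R Y).d 1 0 ≫ K := by
    refine chains_hom_ext R fun s => ?_
    obtain ⟨x, y, δ, hs⟩ := exists_pathSimplex s
    rw [ModuleCat.hom_sub, LinearMap.sub_apply, ModuleCat.hom_comp, ModuleCat.hom_comp,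
      LinearMap.comp_apply, LinearMap.comp_apply, ι_chainsDesc_apply, homologyι_loopHomologyClass,
      pathClass_trans, pathClass_trans, pathClass_symm]
    conv_rhs => rw [hγ s]
    rw [d_pathSimplex, map_sub, ι_chainsDesc_apply, ι_chainsDesc_apply, Equiv.apply_symm_apply,
      Equiv.apply_symm_apply]
    change _ = pathClass R (γ s) - (pathClass R (c (x₁ s)) - pathClass R (c (x₀ s)))
    abel
  have h2 : (chains R Y).iCycles 1 ≫ L = (chains R Y).homologyπ 1 := by
    rw [← cancel_mono ((chains R Y).homologyι 1), Category.assoc, h, HomologicalComplex.homology_π_ι]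
    simp
  have h3 : LinearMap.range L.hom ≤
      Submodule.span R (Set.range fun γ : Path y y => loopHomologyClass R γ) := by
    rw [LinearMap.range_le_iff_comap]
    refine submodule_chains_eq_top R _ fun s => ?_
    rw [Submodule.mem_comap, ι_chainsDesc_apply]
    exact Submodule.subset_span ⟨_, rfl⟩
  rw [eq_top_iff]
  rintro z -
  obtain ⟨w, rfl⟩ := (ModuleCat.epi_iff_surjective ((chains R Y).homologyπ 1)).1 inferInstance z
  rw [← h2]
  exact h3 ⟨_, rfl⟩

theorem span_loopClass [PathConnectedSpace Y] (y : Y) :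
    Submodule.span R (Set.range fun γ : Path y y => loopClass R γ) = ⊤ :=
  span_loopHomologyClass R y

instance : SimplyConnectedSpace (stdSimplex ℝ (Fin 3)) :=
  have := (convex_stdSimplex ℝ (Fin 3)).contractibleSpace ⟨_, single_mem_stdSimplex ℝ 0⟩
  inferInstance

/-- An additive homotopy invariant of paths is a homomorphism on first homology. -/
theorem exists_linearMap_loopClass {A : Type} [AddCommGroup A] [Module R A]
    (Φ : ∀ {x y : Y}, Path x y → A)
    (hΦ : ∀ {x y : Y} {γ γ' : Path x y}, γ.Homotopic γ' → Φ γ = Φ γ')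
    (hΦ' : ∀ {x y z : Y} (γ : Path x y) (γ' : Path y z), Φ (γ.trans γ') = Φ γ + Φ γ') :
    ∃ f : H1 R Y →ₗ[R] A, ∀ {y : Y} (γ : Path y y), f (loopClass R γ) = Φ γ := by
  choose x₀ x₁ γ hγ using exists_pathSimplex (Y := Y)
  let F : (chains R Y).X 1 ⟶ ModuleCat.of R A := chainsDesc R 1 fun s => Φ (γ s)
  have hF {x y : Y} (δ : Path x y) : F.hom (((TopCat.toSSet.obj (TopCat.of Y)).ιChainComplex
      (R := ModuleCat.of R R) (pathSimplex δ)).hom (1 : R)) = Φ δ := by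
    rw [ι_chainsDesc_apply]
    -- The path chosen for a simplex has its own endpoints, which agree with those of `δ` only
    -- propositionally.
    have key : ∀ {x' y' : Y} (δ' : Path x' y'), (∀ t, δ' t = δ t) → Φ δ' = Φ δ := by
      intro x' y' δ' h
      obtain rfl : x' = x := by simpa using h 0
      obtain rfl : y' = y := by simpa using h 1
      rw [show δ' = δ from Path.ext (funext h)]
    exact key _ fun t => (eq_of_pathSimplex_eq (hγ _) t).symm
  have hd : (chains R Y).d 2 1 ≫ F = 0 := by
    refine chains_hom_ext R fun s => ?_
    obtain ⟨τ, rfl⟩ := twoSimplex_surjective s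
    rw [← LinearMap.comp_apply, ← ModuleCat.hom_comp, ← Category.assoc, SSet.ιChainComplex_d]
    simp only [Preadditive.sum_comp, Preadditive.zsmul_comp, ModuleCat.hom_sum, ModuleCat.hom_smul,
      LinearMap.sum_apply, LinearMap.smul_apply, ModuleCat.hom_zero, LinearMap.zero_apply,
      δ_twoSimplex, ModuleCat.hom_comp, LinearMap.comp_apply, hF]
    refine (Fin.sum_univ_three _).trans ?_
    let e₂ : Path (X := stdSimplex ℝ (Fin 3)) (stdSimplex.vertex 0) (stdSimplex.vertex 1) := simplexEdge 2
    let e₀ : Path (X := stdSimplex ℝ (Fin 3)) (stdSimplex.vertex 1) (stdSimplex.vertex 2) := simplexEdge 0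
    let e₁ : Path (X := stdSimplex ℝ (Fin 3)) (stdSimplex.vertex 0) (stdSimplex.vertex 2) := simplexEdge 1
    -- The simplex is simply connected, so going around through vertex 1 is homotopic to the direct
    -- edge; `Φ` therefore kills boundaries.
    have h := hΦ ((SimplyConnectedSpace.paths_homotopic (e₂.trans e₀) e₁).map τ)
    rw [Path.map_trans, hΦ'] at h
    have h' : Φ ((simplexEdge 2).map τ.continuous) + Φ ((simplexEdge 0).map τ.continuous) =
      Φ ((simplexEdge 1).map τ.continuous) := h
    rw [← h']
    simp
  let f := (chains R Y).descOpcycles F 2 (by simp) hd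
  refine ⟨((chains R Y).homologyι 1 ≫ f).hom, fun {y} δ => ?_⟩
  change ((chains R Y).homologyι 1 ≫ f).hom (loopHomologyClass R δ) = _
  rw [ModuleCat.hom_comp, LinearMap.comp_apply, homologyι_loopHomologyClass, pathClass,
    ← LinearMap.comp_apply, ← ModuleCat.hom_comp, Category.assoc,
    HomologicalComplex.p_descOpcycles, ModuleCat.hom_comp, LinearMap.comp_apply, hF]

theorem loopClass_congr {x y : Y} {γ : Path x x} {γ' : Path y y} (h : ∀ t, γ t = γ' t) :
    loopClass R γ = loopClass R γ' :=
  loopClass_eq_of_pathClass_eq R (pathClass_congr R h)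

theorem loopClass_eq_of_homotopic {y : Y} {γ γ' : Path y y} (h : γ.Homotopic γ') :
    loopClass R γ = loopClass R γ' :=
  loopClass_eq_of_pathClass_eq R (pathClass_eq_of_homotopic R h)

theorem loopClass_trans {y : Y} (γ γ' : Path y y) :
    loopClass R (γ.trans γ') = loopClass R γ + loopClass R γ' := by
  refine homologyι_injective R ((homologyι_loopHomologyClass R _).trans ?_)
  rw [pathClass_trans, ← homologyι_loopHomologyClass, ← homologyι_loopHomologyClass, ← map_add]
  rfl

theorem loopClass_symm {y : Y} (γ : Path y y) : loopClass R γ.symm = - loopClass R γ := by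
  refine homologyι_injective R ((homologyι_loopHomologyClass R _).trans ?_)
  rw [pathClass_symm, ← homologyι_loopHomologyClass, ← map_neg]
  rfl

theorem loopClass_refl (y : Y) : loopClass R (Path.refl y) = 0 := by
  refine homologyι_injective R ((homologyι_loopHomologyClass R _).trans ?_)
  rw [pathClass_refl]
  exact (map_zero ((chains R Y).homologyι 1).hom).symm

/-- Freely homotopic loops are homologous. -/
theorem loopClass_conj {x y : Y} (ρ : Path x y) (γ : Path y y) :
    loopClass R ((ρ.trans γ).trans ρ.symm) = loopClass R γ :=
  loopClass_eq_of_pathClass_eq R (by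
    rw [pathClass_trans, pathClass_trans, pathClass_symm, add_right_comm, add_neg_cancel, zero_add])

end Singular

/-! ### Winding numbers -/

theorem liftPath_exp_add (γ : C(unitInterval, Circle)) (e : ℝ) (h : γ 0 = Circle.exp e) (k : ℤ)
    (h' : γ 0 = Circle.exp (e + k * (2 * Real.pi))) (t : unitInterval) :
    Circle.isCoveringMap_exp.liftPath γ (e + k * (2 * Real.pi)) h' t =
      Circle.isCoveringMap_exp.liftPath γ e h t + k * (2 * Real.pi) := by
  have := (Circle.isCoveringMap_exp.eq_liftPath_iff h'
    (Γ := fun t => Circle.isCoveringMap_exp.liftPath γ e h t + k * (2 * Real.pi))).2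
    ⟨by fun_prop, ?_, ?_⟩
  · exact (congrFun this t).symm
  · funext t
    rw [← congrFun (Circle.isCoveringMap_exp.liftPath_lifts γ e h) t]
    simp only [Function.comp_apply]
    exact Circle.exp_eq_exp.2 ⟨k, rfl⟩
  · simp only [IsCoveringMap.liftPath_zero]

/-- The number of turns of a real angle. -/
def turns (θ : ℝ) : ℤ := ⌊θ / (2 * Real.pi)⌋

/-- Equivariance under full turns makes the difference of `turns` at the two ends independent of the
lift. Such differences telescope, so `winding` is an additive integer even for paths that are not
closed. -/
theorem turns_add (θ : ℝ) (k : ℤ) : turns (θ + k * (2 * Real.pi)) = turns θ + k := by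
  have : (2 * Real.pi) ≠ 0 := by positivity
  rw [turns, turns, add_div, mul_div_cancel_right₀ _ this, Int.floor_add_intCast]

/-- The winding number of a path in the circle, rounded so as to be additive. -/
def winding {x y : Circle} (γ : Path x y) : ℤ :=
  turns (Circle.isCoveringMap_exp.liftPath γ (Complex.arg x) (by simp [Circle.exp_arg]) 1) -
    turns (Complex.arg x)

theorem winding_eq_liftPath {x y : Circle} (γ : Path x y) (e : ℝ) (h : γ.toContinuousMap 0 = Circle.exp e) :
    winding γ = turns (Circle.isCoveringMap_exp.liftPath γ e h 1) - turns e := by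
  have h1 : Circle.exp e = Circle.exp (Complex.arg x) := by
    rw [← h, Circle.exp_arg]; exact γ.source
  obtain ⟨k, rfl⟩ := Circle.exp_eq_exp.1 h1
  rw [winding, liftPath_exp_add γ _ (by simp [Circle.exp_arg]), turns_add, turns_add]
  ring

/-- The winding number, computed by any lift to the line. -/
theorem winding_eq {x y : Circle} (γ : Path x y) (θ : C(unitInterval, ℝ))
    (h : ∀ t, Circle.exp (θ t) = γ t) : winding γ = turns (θ 1) - turns (θ 0) := by
  have h2 : θ = Circle.isCoveringMap_exp.liftPath γ.toContinuousMap (θ 0) (h 0).symm :=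
    (Circle.isCoveringMap_exp.eq_liftPath_iff' (h 0).symm).2 ⟨funext h, rfl⟩
  rw [winding_eq_liftPath γ (θ 0) (h 0).symm]
  exact congrArg (fun f : C(unitInterval, ℝ) => turns (f 1) - turns (θ 0)) h2.symm

theorem exists_lift_exp {x y : Circle} (γ : Path x y) :
    ∃ θ : C(unitInterval, ℝ), ∀ t, Circle.exp (θ t) = γ t := by
  obtain ⟨θ, h, -⟩ := Circle.isCoveringMap_exp.exists_path_lifts γ.toContinuousMap (Complex.arg x)
    (by rw [Circle.exp_arg]; exact γ.source)
  exact ⟨θ, congrFun h⟩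

theorem winding_eq_of_homotopic {x y : Circle} {γ γ' : Path x y} (h : γ.Homotopic γ') :
    winding γ = winding γ' := by
  rw [winding, winding]
  congr 2
  exact Circle.isCoveringMap_exp.liftPath_apply_one_eq_of_homotopicRel h _ _ _

theorem winding_trans {x y z : Circle} (γ : Path x y) (γ' : Path y z) :
    winding (γ.trans γ') = winding γ + winding γ' := by
  obtain ⟨θ, h⟩ := exists_lift_exp γ
  have h1 : γ'.toContinuousMap 0 = Circle.exp (θ 1) := by
    rw [h 1]; exact γ'.source.trans γ.target.symm
  obtain ⟨θ', h', h0⟩ := Circle.isCoveringMap_exp.exists_path_lifts γ'.toContinuousMap (θ 1) h1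
  let p : Path (θ 0) (θ 1) := ⟨θ, rfl, rfl⟩
  let p' : Path (θ 1) (θ' 1) := ⟨θ', h0, rfl⟩
  rw [winding_eq γ θ h, winding_eq γ' θ' (congrFun h'), winding_eq _ (p.trans p').toContinuousMap]
  · change turns ((p.trans p') 1) - turns ((p.trans p') 0) = _
    rw [Path.target, Path.source, h0]; ring
  · intro t
    change Circle.exp ((p.trans p') t) = _
    rw [Path.trans_apply, Path.trans_apply]
    split_ifs
    · exact h _
    · exact congrFun h' _

theorem winding_congr {x y x' y' : Circle} {γ : Path x y} {γ' : Path x' y'}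
    (h : ∀ t, γ t = γ' t) : winding γ = winding γ' := by
  obtain rfl : x = x' := by simpa using h 0
  obtain rfl : y = y' := by simpa using h 1
  rw [show γ = γ' from Path.ext (funext h)]

theorem winding_refl (x : Circle) : winding (Path.refl x) = 0 := by
  rw [winding_eq _ (.const _ (Complex.arg x)) fun t => by simp [Circle.exp_arg]]
  simp

theorem winding_symm {x y : Circle} (γ : Path x y) : winding γ.symm = - winding γ := by
  obtain ⟨θ, h⟩ := exists_lift_exp γ
  rw [winding_eq _ (θ.comp ⟨unitInterval.symm, by fun_prop⟩) fun t => h _, winding_eq γ θ h]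
  simp

/-- The degree homomorphism `H₁(S¹; R) → R`. -/
theorem exists_degree (R : Type) [CommRing R] :
    ∃ f : H1 R Circle →ₗ[R] R, ∀ {y : Circle} (γ : Path y y), f (loopClass R γ) = winding γ :=
  exists_linearMap_loopClass R (fun γ => (winding γ : R))
    (fun h => by rw [winding_eq_of_homotopic h]) fun γ γ' => by rw [winding_trans]; push_cast; rfl

theorem winding_eq_zero_of_loopClass (R : Type) [CommRing R] {Y : Type} [TopologicalSpace Y]
    (f : C(Y, Circle)) {y : Y} (γ : Path y y) (h : loopClass R γ = 0) :
    (winding (γ.map f.continuous) : R) = 0 := by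
  obtain ⟨d, hd⟩ := exists_degree R
  rw [← hd, ← H1map_loopClass, h, map_zero, map_zero]

/-! ### Automorphisms of the free group of rank two -/

section Nielsen

open FreeGroup

variable {α : Type*} [DecidableEq α]

/-! ### Reduced words and products without cancellation -/

/-- No letter cancels in the product of the reduced words of `x` and `y`. -/
def NoCancel (x y : FreeGroup α) : Prop :=
  ∀ s, x⁻¹.toWord.head? = some s → y.toWord.head? ≠ some s

theorem NoCancel.toWord_mul {x y : FreeGroup α} (h : NoCancel x y) :
    (x * y).toWord = x.toWord ++ y.toWord := by
  rw [FreeGroup.toWord_mul]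
  apply IsReduced.reduce_eq
  refine List.isChain_append.2 ⟨isReduced_toWord, isReduced_toWord, fun a ha b hb hab => ?_⟩
  by_contra hne
  refine h b ?_ hb
  rw [toWord_inv, invRev, List.head?_reverse, List.getLast?_map, ha]
  obtain ⟨a1, a2⟩ := a
  obtain ⟨b1, b2⟩ := b
  simp only at hab hne
  subst hab
  cases a2 <;> cases b2 <;> simp_all

theorem head?_toWord_eq_none {x : FreeGroup α} : x.toWord.head? = none ↔ x = 1 := by
  rw [List.head?_eq_none_iff, toWord_eq_nil_iff]

/-- The reduced word of the product is the concatenation of nonempty words. The first letter is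
carried through the induction because it decides whether the next factor on the left cancels. -/
theorem noCancel_prod {x : FreeGroup α} {l : List (FreeGroup α)} (h1 : ∀ y ∈ x :: l, y ≠ 1)
    (h : (x :: l).IsChain NoCancel) :
    (x :: l).prod.toWord.head? = x.toWord.head? ∧ (x :: l).length ≤ norm (x :: l).prod := by
  induction l generalizing x with
  | nil =>
    have := h1 x (by simp)
    refine ⟨by simp, ?_⟩
    simp only [List.length_singleton, List.prod_singleton]
    exact Nat.one_le_iff_ne_zero.2 (by rwa [Ne, FreeGroup.norm_eq_zero])
  | cons y l ih =>
    rw [List.isChain_cons_cons] at h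
    obtain ⟨i1, i2⟩ := ih (fun z hz => h1 z (by simp_all)) h.2
    have hx := h1 x (by simp)
    have hn : NoCancel x (y :: l).prod := fun s hs => by rw [i1]; exact h.1 s hs
    have hx' : x.toWord ≠ [] := by rwa [Ne, toWord_eq_nil_iff]
    rw [List.prod_cons, FreeGroup.norm, hn.toWord_mul, List.length_append, List.head?_append_of_ne_nil _ hx']
    refine ⟨rfl, ?_⟩
    have : 0 < x.toWord.length := List.length_pos_iff.2 hx'
    rw [FreeGroup.norm] at i2
    simp only [List.length_cons] at i2 ⊢
    omega

theorem norm_strip {g : FreeGroup α} {s : α × Bool} (h : g.toWord.head? = some s) :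
    norm ((mk [s])⁻¹ * g) + 1 = norm g := by
  obtain ⟨L, hL⟩ : ∃ L, g.toWord = s :: L := by
    cases hg : g.toWord with
    | nil => simp [hg] at h
    | cons a L => simp [hg] at h; exact ⟨L, by rw [h]⟩
  have hr : IsReduced L := (isReduced_toWord (x := g)).infix ⟨[s], [], by simp [hL]⟩
  have hg : g = mk [s] * mk L := by rw [← mk_toWord (x := g), hL]; simp
  rw [hg, inv_mul_cancel_left, ← hg, FreeGroup.norm, FreeGroup.norm, toWord_mk, hr.reduce_eq, hL]
  rfl

theorem norm_mk_inv_mul_le (s : α × Bool) (g : FreeGroup α) :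
    norm ((mk [s])⁻¹ * g) ≤ norm g + 1 := by
  have h1 := norm_mul_le (mk [s])⁻¹ g
  rw [norm_inv_eq] at h1
  have h2 : norm (mk [s]) ≤ 1 := norm_mk_le
  omega

/-- A reduced word has the form `u w u⁻¹` with `w` cyclically reduced, and its positive powers are
`u wⁿ u⁻¹` without further cancellation. -/
theorem head?_toWord_pow_succ (x : FreeGroup α) (n : ℕ) :
    (x ^ (n + 1)).toWord.head? = x.toWord.head? := by
  have h := reduceCyclically.reduce_flatten_replicate_succ (isReduced_toWord (x := x))
  have h0 := h 0
  have hn := h n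
  rw [← toWord_pow] at h0 hn
  rw [zero_add, pow_one] at h0
  rw [hn]
  conv_rhs => rw [h0]
  cases reduceCyclically.conjugator x.toWord with
  | cons a l => simp
  | nil =>
    cases reduceCyclically x.toWord with
    | nil => simp
    | cons a l => simp [List.replicate_succ]

theorem head?_toWord_zpow (x : FreeGroup α) {n : ℤ} (hn : n ≠ 0) :
    (x ^ n).toWord.head? = x.toWord.head? ∨ (x ^ n).toWord.head? = x⁻¹.toWord.head? := by
  obtain ⟨m, rfl | rfl⟩ := n.eq_nat_or_neg
  all_goals obtain ⟨k, rfl⟩ : ∃ k, m = k + 1 := Nat.exists_eq_succ_of_ne_zero (by simpa using hn)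
  · left; rw [zpow_natCast, head?_toWord_pow_succ]
  · right; rw [zpow_neg, zpow_natCast, ← inv_pow, head?_toWord_pow_succ]

/-! ### Theta triples -/

section Theta

variable {G : Type*} [Group G]

/-- `p q⁻¹` and `r q⁻¹` generate the group. -/
def ThetaGenerates (p q r : G) : Prop :=
  ∀ K : Subgroup G, p * q⁻¹ ∈ K → r * q⁻¹ ∈ K → K = ⊤

/-- The commutator of `p q⁻¹` and `r q⁻¹`, up to conjugation. -/
def thetaCommutator (p q r : G) : G := p * q⁻¹ * r * p⁻¹ * q * r⁻¹

/-- `g` is conjugate to `c` or to its inverse. -/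
def IsConjOrInv (g c : G) : Prop := IsConj g c ∨ IsConj g c⁻¹

theorem isConj_inv_inv {g h : G} (H : IsConj g h) : IsConj g⁻¹ h⁻¹ := by
  obtain ⟨c, rfl⟩ := isConj_iff.1 H
  exact isConj_iff.2 ⟨c, by group⟩

theorem IsConjOrInv.of_isConj {g h c : G} (H : IsConj h g) (hg : IsConjOrInv g c) :
    IsConjOrInv h c :=
  hg.imp H.trans H.trans

theorem IsConjOrInv.of_isConj_inv {g h c : G} (H : IsConj h g⁻¹) (hg : IsConjOrInv g c) :
    IsConjOrInv h c :=
  hg.symm.imp (fun k => H.trans (by simpa using isConj_inv_inv k)) fun k => H.trans (isConj_inv_inv k)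

namespace ThetaGenerates

variable {p q r : G}

/-- The moves on labelled theta graphs are rotation of the edges, relabelling at one vertex
(`mul_left`) and exchange of the vertices (`inv`). A rose also allows reversal of a petal
(`inv_right`). Each has a counterpart below for the commutator. -/
theorem rotate (h : ThetaGenerates p q r) : ThetaGenerates q r p := fun K h1 h2 =>
  h K (by simpa using K.mul_mem h2 (K.inv_mem h1)) (by simpa using K.inv_mem h1)

theorem mul_left (h : ThetaGenerates p q r) (g : G) : ThetaGenerates (g * p) (g * q) (g * r) := by
  intro K h1 h2
  have := h (K.comap (MulAut.conj g).toMonoidHom)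
    (by simpa [mul_assoc] using h1) (by simpa [mul_assoc] using h2)
  rw [eq_top_iff]
  intro x _
  have hx : (MulAut.conj g)⁻¹ x ∈ K.comap (MulAut.conj g).toMonoidHom := by rw [this]; trivial
  simpa [mul_assoc] using hx

theorem inv (h : ThetaGenerates p q r) : ThetaGenerates p⁻¹ q⁻¹ r⁻¹ := by
  have h' := h.mul_left q⁻¹
  intro K h1 h2
  refine h' K ?_ ?_
  · simpa [mul_assoc] using K.inv_mem h1
  · simpa [mul_assoc] using K.inv_mem h2

theorem inv_right (h : ThetaGenerates p 1 r) : ThetaGenerates p 1 r⁻¹ := fun K h1 h2 =>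
  h K h1 (by simpa using K.inv_mem h2)

end ThetaGenerates

/-- The word `p q⁻¹ r p⁻¹ q r⁻¹` traverses every edge once in each direction; rotating the labels is
a cyclic shift of it. -/
theorem isConj_thetaCommutator_rotate (p q r : G) :
    IsConj (thetaCommutator p q r) (thetaCommutator q r p) :=
  isConj_iff.2 ⟨q * r⁻¹, by simp only [thetaCommutator]; group⟩

theorem isConj_thetaCommutator_mul_left (g p q r : G) :
    IsConj (thetaCommutator p q r) (thetaCommutator (g * p) (g * q) (g * r)) :=
  isConj_iff.2 ⟨g, by simp only [thetaCommutator]; group⟩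

theorem isConj_thetaCommutator_inv (p q r : G) :
    IsConj (thetaCommutator p q r) (thetaCommutator p⁻¹ q⁻¹ r⁻¹) :=
  isConj_iff.2 ⟨p⁻¹ * q * r⁻¹, by simp only [thetaCommutator]; group⟩

theorem isConj_thetaCommutator_inv_right (p r : G) :
    IsConj (thetaCommutator p 1 r) (thetaCommutator p 1 r⁻¹)⁻¹ :=
  isConj_iff.2 ⟨r⁻¹, by simp only [thetaCommutator]; group⟩

end Theta

/-! ### Edge paths in an immersed theta graph -/

/-- The reduced words along the edges of an immersed theta graph. -/
def edgeWord (e : Fin 3 → FreeGroup α) (l : List (Fin 3)) : List (FreeGroup α) :=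
  match l with
  | [] => []
  | i :: l => (if Even l.length then (e i)⁻¹ else e i) :: edgeWord e l

theorem length_edgeWord {β : Type*} (e : Fin 3 → FreeGroup β) (l : List (Fin 3)) :
    (edgeWord e l).length = l.length := by
  induction l with
  | nil => rfl
  | cons i l ih => simp [edgeWord, ih]

theorem ne_one_of_mem_edgeWord {β : Type*} {e : Fin 3 → FreeGroup β} (he : ∀ i, e i ≠ 1)
    {l : List (Fin 3)} {y : FreeGroup β} (hy : y ∈ edgeWord e l) : y ≠ 1 := by
  induction l with
  | nil => simp [edgeWord] at hy
  | cons i l ih =>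
    rw [edgeWord, List.mem_cons] at hy
    rcases hy with rfl | hy
    · split_ifs <;> simp [he]
    · exact ih hy

theorem isChain_edgeWord {e : Fin 3 → FreeGroup α}
    (h1 : ∀ i j, i ≠ j → NoCancel (e i) (e j)⁻¹) (h2 : ∀ i j, i ≠ j → NoCancel (e i)⁻¹ (e j))
    {l : List (Fin 3)} (hl : l.IsChain (· ≠ ·)) : (edgeWord e l).IsChain NoCancel := by
  induction l with
  | nil => simp [edgeWord]
  | cons i l ih =>
    cases l with
    | nil => simp [edgeWord]
    | cons j l =>
      rw [List.isChain_cons_cons] at hl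
      have := ih hl.2
      rw [edgeWord] at this ⊢
      rw [edgeWord, List.isChain_cons_cons]
      refine ⟨?_, this⟩
      by_cases hp : Even l.length
      · simpa [hp, Nat.even_add_one] using h1 i j hl.1
      · simpa [hp, Nat.even_add_one] using h2 i j hl.1

/-- Adding an edge in front either backtracks, and cancels the first edge, or keeps the path
reduced. In both cases the parity flips, which matches the alternation between the two vertices. -/
theorem exists_edgeWord_cons {β : Type*} (e : Fin 3 → FreeGroup β) (i : Fin 3) {l : List (Fin 3)}
    (hl : l.IsChain (· ≠ ·)) : ∃ l' : List (Fin 3), l'.IsChain (· ≠ ·) ∧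
      (Even l'.length ↔ ¬ Even l.length) ∧ (edgeWord e l').prod =
        (if Even l.length then (e i)⁻¹ else e i) * (edgeWord e l).prod := by
  have hcons : l.head? ≠ some i → (i :: l).IsChain (· ≠ ·) := by
    intro h
    cases l with
    | nil => simp
    | cons j m => exact List.isChain_cons_cons.2 ⟨by simpa [eq_comm] using h, hl⟩
  by_cases h : l.head? = some i
  · obtain ⟨m, rfl⟩ : ∃ m, l = i :: m := by
      cases l with
      | nil => simp at h
      | cons j m => simp at h; exact ⟨m, by rw [h]⟩
    refine ⟨m, hl.tail, by simp [Nat.even_add_one], ?_⟩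
    rw [edgeWord, List.prod_cons]
    by_cases hp : Even m.length <;> simp [hp, Nat.even_add_one]
  · exact ⟨i :: l, hcons h, by simp [Nat.even_add_one], by simp [edgeWord]⟩

/-- An immersed theta graph does not carry the whole free group. -/
theorem not_thetaGenerates_of_immersed [Nonempty α] {e : Fin 3 → FreeGroup α} (he : ∀ i, e i ≠ 1)
    (h1 : ∀ i j, i ≠ j → NoCancel (e i) (e j)⁻¹) (h2 : ∀ i j, i ≠ j → NoCancel (e i)⁻¹ (e j)) :
    ¬ ThetaGenerates (e 0) (e 1) (e 2) := by
  intro hg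
  have step (i j : Fin 3) {g : FreeGroup α} (h : ∃ l : List (Fin 3), l.IsChain (· ≠ ·) ∧
      Even l.length ∧ g = (edgeWord e l).prod) : ∃ l : List (Fin 3), l.IsChain (· ≠ ·) ∧
      Even l.length ∧ e i * (e j)⁻¹ * g = (edgeWord e l).prod := by
    obtain ⟨l, hl, hp, rfl⟩ := h
    obtain ⟨l', hl', hp', h'⟩ := exists_edgeWord_cons e j hl
    obtain ⟨l'', hl'', hp'', h''⟩ := exists_edgeWord_cons e i hl'
    have hn : ¬ Even l'.length := fun h => hp'.1 h hp
    refine ⟨l'', hl'', hp''.2 hn, ?_⟩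
    rw [h'', h', if_pos hp, if_neg hn, mul_assoc]
  have htop := hg (Subgroup.closure {e 0 * (e 1)⁻¹, e 2 * (e 1)⁻¹})
    (Subgroup.subset_closure (by simp)) (Subgroup.subset_closure (by simp))
  obtain ⟨a⟩ := ‹Nonempty α›
  have ha : of a ∈ Subgroup.closure {e 0 * (e 1)⁻¹, e 2 * (e 1)⁻¹} := by rw [htop]; trivial
  have key : ∀ g ∈ Subgroup.closure {e 0 * (e 1)⁻¹, e 2 * (e 1)⁻¹}, ∃ l : List (Fin 3),
      l.IsChain (· ≠ ·) ∧ Even l.length ∧ g = (edgeWord e l).prod := by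
    intro g hg
    induction hg using Subgroup.closure_induction_left with
    | one => exact ⟨[], by simp, by simp, by simp [edgeWord]⟩
    | mul_left x hx y hy ih =>
      rcases hx with rfl | rfl
      exacts [step _ _ ih, step _ _ ih]
    | inv_mul_cancel x hx y hy ih =>
      rcases hx with rfl | rfl <;> rw [mul_inv_rev, inv_inv]
      exacts [step _ _ ih, step _ _ ih]
  obtain ⟨l, hl, hp, hal⟩ := key _ ha
  -- A nonempty even edge path has at least two edges, hence word length at least two, while a free
  -- generator has length one.
  cases l with
  | nil => exact of_ne_one a (by simp only [edgeWord, List.prod_nil] at hal; exact hal)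
  | cons i l =>
    have h3 := (noCancel_prod (fun y hy => ne_one_of_mem_edgeWord he (l := i :: l) hy)
      (isChain_edgeWord h1 h2 hl)).2
    have h4 := length_edgeWord e (i :: l)
    rw [edgeWord] at hal h4
    rw [← hal, norm_of, h4, List.length_cons] at h3
    rw [List.length_cons, Nat.even_add_one] at hp
    simp_all

/-! ### Alternating words in an immersed rose -/

/-- The product of the syllables of an alternating word in the powers of `x true`, `x false`. -/
def syllables {β : Type*} (x : Bool → FreeGroup β) (l : List (Bool × ℤ)) : List (FreeGroup β) :=
  l.map fun s => x s.1 ^ s.2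

theorem exists_syllables_cons {β : Type*} (x : Bool → FreeGroup β) (b : Bool) (k : ℤ)
    {l : List (Bool × ℤ)} (hl : l.IsChain fun s t => s.1 ≠ t.1) (h0 : ∀ s ∈ l, s.2 ≠ 0) :
    ∃ l' : List (Bool × ℤ), (l'.IsChain fun s t => s.1 ≠ t.1) ∧ (∀ s ∈ l', s.2 ≠ 0) ∧
      (syllables x l').prod = x b ^ k * (syllables x l).prod := by
  by_cases hk : k = 0
  · exact ⟨l, hl, h0, by simp [hk]⟩
  cases l with
  | nil => exact ⟨[(b, k)], by simp, by simpa using hk, by simp [syllables]⟩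
  | cons s m =>
    obtain ⟨b', n⟩ := s
    by_cases hb : b = b'
    · subst hb
      by_cases hkn : k + n = 0
      · refine ⟨m, hl.tail, fun s hs => h0 s (by simp [hs]), ?_⟩
        simp [syllables, ← mul_assoc, ← zpow_add, hkn]
      · refine ⟨(b, k + n) :: m, ?_, ?_, ?_⟩
        · cases m with
          | nil => simp
          | cons t m =>
            rw [List.isChain_cons_cons] at hl ⊢
            exact hl
        · intro s hs
          rcases List.mem_cons.1 hs with rfl | hs
          exacts [hkn, h0 s (by simp [hs])]
        · simp [syllables, zpow_add, mul_assoc]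
    · refine ⟨(b, k) :: (b', n) :: m, List.isChain_cons_cons.2 ⟨hb, hl⟩, ?_, by simp [syllables]⟩
      intro s hs
      rcases List.mem_cons.1 hs with rfl | hs
      exacts [hk, h0 s hs]

/-- A nonzero power begins with the same letter as its base or the inverse of its base, so the
hypothesis on these four elements controls all syllables. The petals themselves need not be
cyclically reduced. -/
theorem isChain_syllables {x : Bool → FreeGroup α}
    (h : ∀ u v : FreeGroup α, (u = x true ∨ u = (x true)⁻¹) → (v = x false ∨ v = (x false)⁻¹) →
      u.toWord.head? ≠ v.toWord.head?) {l : List (Bool × ℤ)}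
    (hl : l.IsChain fun s t => s.1 ≠ t.1) (h0 : ∀ s ∈ l, s.2 ≠ 0) :
    (syllables x l).IsChain NoCancel := by
  have hz (b : Bool) (n : ℤ) (hn : n ≠ 0) : ∃ u, (u = x b ∨ u = (x b)⁻¹) ∧
      (x b ^ n).toWord.head? = u.toWord.head? := by
    rcases head?_toWord_zpow (x b) hn with h | h
    exacts [⟨_, .inl rfl, h⟩, ⟨_, .inr rfl, h⟩]
  induction l with
  | nil => simp [syllables]
  | cons s l ih =>
    cases l with
    | nil => simp [syllables]
    | cons t l =>
      rw [List.isChain_cons_cons] at hl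
      refine List.isChain_cons_cons.2 ⟨?_, ih hl.2 fun s hs => h0 s (by simp_all)⟩
      obtain ⟨b, n⟩ := s
      obtain ⟨b', m⟩ := t
      have hn : n ≠ 0 := h0 (b, n) (by simp)
      have hm : m ≠ 0 := h0 (b', m) (by simp)
      intro s hs hs'
      obtain ⟨u, hu, hu'⟩ := hz b (-n) (by simpa using hn)
      obtain ⟨v, hv, hv'⟩ := hz b' m hm
      simp only [← zpow_neg] at hs hs'
      rw [hu'] at hs
      rw [hv'] at hs'
      have hbb : b ≠ b' := hl.1
      cases b <;> cases b' <;> simp only [ne_eq, not_true_eq_false, reduceCtorEq,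
        not_false_eq_true] at hbb
      · exact h v u hv hu (hs'.trans hs.symm)
      · exact h u v hu hv (hs.trans hs'.symm)

/-- If no letters cancel between powers of `p` and powers of `r`, and `p`, `r` generate the free
group, then every free generator is a power of `p` or of `r`. -/
theorem of_eq_zpow_of_immersed {p r : FreeGroup α} (hp : p ≠ 1) (hr : r ≠ 1)
    (h : ∀ u v : FreeGroup α, (u = p ∨ u = p⁻¹) → (v = r ∨ v = r⁻¹) →
      u.toWord.head? ≠ v.toWord.head?) (hg : ThetaGenerates p 1 r) (a : α) :
    (∃ n : ℤ, of a = p ^ n) ∨ ∃ n : ℤ, of a = r ^ n := by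
  let x : Bool → FreeGroup α := fun b => if b then p else r
  have hx : ∀ b, x b ≠ 1 := by intro b; cases b <;> simpa [x]
  have htop := hg (Subgroup.closure {p, r}) (Subgroup.subset_closure (by simp))
    (Subgroup.subset_closure (by simp))
  have key : ∀ g ∈ Subgroup.closure {p, r}, ∃ l : List (Bool × ℤ),
      (l.IsChain fun s t => s.1 ≠ t.1) ∧ (∀ s ∈ l, s.2 ≠ 0) ∧ g = (syllables x l).prod := by
    intro g hg
    induction hg using Subgroup.closure_induction_left with
    | one => exact ⟨[], by simp, by simp, by simp [syllables]⟩
    | mul_left y hy z hz ih =>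
      obtain ⟨l, h1, h2, rfl⟩ := ih
      rcases hy with rfl | rfl
      · obtain ⟨l', h3, h4, h5⟩ := exists_syllables_cons x true 1 h1 h2
        exact ⟨l', h3, h4, by rw [h5]; simp [x]⟩
      · obtain ⟨l', h3, h4, h5⟩ := exists_syllables_cons x false 1 h1 h2
        exact ⟨l', h3, h4, by rw [h5]; simp [x]⟩
    | inv_mul_cancel y hy z hz ih =>
      obtain ⟨l, h1, h2, rfl⟩ := ih
      rcases hy with rfl | rfl
      · obtain ⟨l', h3, h4, h5⟩ := exists_syllables_cons x true (-1) h1 h2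
        exact ⟨l', h3, h4, by rw [h5]; simp [x]⟩
      · obtain ⟨l', h3, h4, h5⟩ := exists_syllables_cons x false (-1) h1 h2
        exact ⟨l', h3, h4, by rw [h5]; simp [x]⟩
  obtain ⟨l, h1, h2, h3⟩ := key (of a) (by rw [htop]; trivial)
  have hc := isChain_syllables (x := x) (by simpa [x] using h) h1 h2
  have hne : ∀ y ∈ syllables x l, y ≠ 1 := by
    intro y hy hy1
    obtain ⟨⟨b, n⟩, hs, rfl⟩ := List.mem_map.1 hy
    have hn := h2 _ hs
    rcases head?_toWord_zpow (x b) hn with h | h <;> simp only at hy1 <;> rw [hy1] at h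
    · exact hx b (head?_toWord_eq_none.1 (h.symm.trans (by simp)))
    · exact hx b (inv_eq_one.1 (head?_toWord_eq_none.1 (h.symm.trans (by simp))))
  match l, h3, hc, hne with
  | [], h3, _, _ => exact absurd h3 (by simp only [syllables, List.map_nil, List.prod_nil]; exact of_ne_one a)
  | [(true, n)], h3, _, _ => exact .inl ⟨n, by simpa [syllables, x] using h3⟩
  | [(false, n)], h3, _, _ => exact .inr ⟨n, by simpa [syllables, x] using h3⟩
  -- Two syllables would already give word length at least two.
  | s :: t :: l, h3, hc, hne =>
    have := (noCancel_prod hne hc).2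
    change _ ≤ FreeGroup.norm (syllables x (s :: t :: l)).prod at this
    rw [← h3, norm_of] at this
    simp at this

/-! ### Rank two -/

/-- The commutator of the two generators of the free group of rank two. -/
def freeCommutator : FreeGroup (Fin 2) := of 0 * of 1 * (of 0)⁻¹ * (of 1)⁻¹

/-- The exponent sum of a generator is one, which forces `n` to be a unit of `ℤ`. -/
theorem eq_or_eq_inv_of_eq_zpow {β : Type*} {i : β} {x : FreeGroup β} {n : ℤ} (h : of i = x ^ n) :
    x = of i ∨ x = (of i)⁻¹ := by
  let ε : FreeGroup β →* Multiplicative ℤ := lift fun _ => .ofAdd 1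
  have h1 : (1 : ℤ) = n * (ε x).toAdd := by
    have := congrArg (fun y => (ε y).toAdd) h
    simpa [ε] using this
  rcases Int.eq_one_or_neg_one_of_mul_eq_one h1.symm with rfl | rfl
  · left; simpa using h.symm
  · right; rw [h]; simp

theorem of_zero_mul_of_one_ne : (of 0 * of 1 : FreeGroup (Fin 2)) ≠ of 1 * of 0 := by
  decide

theorem not_thetaGenerates_one_right (r : FreeGroup (Fin 2)) : ¬ ThetaGenerates 1 1 r := by
  intro h
  have htop := h (Subgroup.zpowers r) (by simp) (by simp)
  have h0 : of 0 ∈ Subgroup.zpowers r := by rw [htop]; trivial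
  have h1 : of 1 ∈ Subgroup.zpowers r := by rw [htop]; trivial
  obtain ⟨n, hn⟩ := Subgroup.mem_zpowers_iff.1 h0
  obtain ⟨m, hm⟩ := Subgroup.mem_zpowers_iff.1 h1
  exact of_zero_mul_of_one_ne (by rw [← hn, ← hm, ← zpow_add, ← zpow_add, add_comm])

theorem isConj_thetaCommutator_inv_left {G : Type*} [Group G] (p r : G) :
    IsConj (thetaCommutator p⁻¹ 1 r) (thetaCommutator p 1 r)⁻¹ :=
  isConj_iff.2 ⟨p, by simp only [thetaCommutator]; group⟩

theorem thetaCommutator_swap {G : Type*} [Group G] (p r : G) :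
    thetaCommutator r 1 p = (thetaCommutator p 1 r)⁻¹ := by
  simp only [thetaCommutator]; group

/-- Each free generator is a power of `p` or of `r`, and not both are powers of the same element
since they do not commute. So `p` and `r` are the standard generators up to order and sign, and
swapping or inverting them affects the commutator only up to conjugation and inversion. -/
theorem isConjOrInv_of_immersed_rose {p r : FreeGroup (Fin 2)}
    (h : ∀ u v : FreeGroup (Fin 2), (u = p ∨ u = p⁻¹) → (v = r ∨ v = r⁻¹) → ∀ s,
      u.toWord.head? = some s → v.toWord.head? ≠ some s) (hg : ThetaGenerates p 1 r) :
    IsConjOrInv (thetaCommutator p 1 r) freeCommutator := by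
  have hp : p ≠ 1 := by
    rintro rfl
    exact not_thetaGenerates_one_right r hg
  have hr : r ≠ 1 := by
    rintro rfl
    exact not_thetaGenerates_one_right p hg.rotate
  have key := of_eq_zpow_of_immersed hp hr (fun u v hu hv huv => by
    obtain ⟨s, hs⟩ : ∃ s, u.toWord.head? = some s := by
      cases hs : u.toWord.head? with
      | some s => exact ⟨s, rfl⟩
      | none =>
        rw [head?_toWord_eq_none] at hs
        rcases hu with rfl | rfl
        exacts [absurd hs hp, absurd (inv_eq_one.1 hs) hp]
    exact h u v hu hv s hs (huv ▸ hs)) hg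
  have hcomm (x : FreeGroup (Fin 2)) (n m : ℤ) (h0 : of 0 = x ^ n) (h1 : of 1 = x ^ m) : False :=
    of_zero_mul_of_one_ne (by rw [h0, h1, ← zpow_add, ← zpow_add, add_comm])
  have hab : IsConjOrInv (thetaCommutator (of 0) 1 (of 1)) freeCommutator := by
    have : thetaCommutator (of 0) 1 (of 1) = freeCommutator := by
      simp [thetaCommutator, freeCommutator]
    exact .inl (this ▸ IsConj.refl _)
  have hswap {p r : FreeGroup (Fin 2)} (h : IsConjOrInv (thetaCommutator p 1 r) freeCommutator) :
      IsConjOrInv (thetaCommutator r 1 p) freeCommutator :=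
    h.of_isConj_inv (by rw [thetaCommutator_swap])
  have hsign {p r : FreeGroup (Fin 2)} {i j : Fin 2} (hp : p = of i ∨ p = (of i)⁻¹)
      (hr : r = of j ∨ r = (of j)⁻¹)
      (h : IsConjOrInv (thetaCommutator (of i) 1 (of j)) freeCommutator) :
      IsConjOrInv (thetaCommutator p 1 r) freeCommutator := by
    have h' : IsConjOrInv (thetaCommutator p 1 (of j)) freeCommutator := by
      rcases hp with rfl | rfl
      exacts [h, h.of_isConj_inv (isConj_thetaCommutator_inv_left _ _)]
    rcases hr with rfl | rfl
    exacts [h', hswap ((hswap h').of_isConj_inv (isConj_thetaCommutator_inv_left _ _))]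
  rcases key 0 with ⟨n, hn⟩ | ⟨n, hn⟩ <;> rcases key 1 with ⟨m, hm⟩ | ⟨m, hm⟩
  · exact (hcomm p n m hn hm).elim
  · exact hsign (eq_or_eq_inv_of_eq_zpow hn) (eq_or_eq_inv_of_eq_zpow hm) hab
  · exact hsign (eq_or_eq_inv_of_eq_zpow hm) (eq_or_eq_inv_of_eq_zpow hn) (hswap hab)
  · exact (hcomm r n m hn hm).elim

/-- **Nielsen's theorem**: the commutator of a generating pair of the free group of rank two is
conjugate to the commutator of the standard generators, or to its inverse. -/
theorem isConjOrInv_thetaCommutator (n : ℕ) : ∀ p q r : FreeGroup (Fin 2),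
    p.norm + q.norm + r.norm = n → ThetaGenerates p q r →
      IsConjOrInv (thetaCommutator p q r) freeCommutator := by
  induction n using Nat.strong_induction_on with
  | _ n ih =>
  -- A fold: removing a shared first letter shortens two labels by one and lengthens the third by at
  -- most one, so the total drops.
  have strip₀ {p q r : FreeGroup (Fin 2)} (hn : p.norm + q.norm + r.norm = n)
      (hg : ThetaGenerates p q r) {s} (hp : p.toWord.head? = some s)
      (hq : q.toWord.head? = some s) : IsConjOrInv (thetaCommutator p q r) freeCommutator := by
    refine (ih _ ?_ _ _ _ rfl (hg.mul_left (mk [s])⁻¹)).of_isConj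
      (isConj_thetaCommutator_mul_left _ _ _ _)
    have := norm_strip hp
    have := norm_strip hq
    have := norm_mk_inv_mul_le s r
    omega
  have rot {p q r : FreeGroup (Fin 2)} (h : IsConjOrInv (thetaCommutator q r p) freeCommutator) :
      IsConjOrInv (thetaCommutator p q r) freeCommutator :=
    h.of_isConj (isConj_thetaCommutator_rotate _ _ _)
  have rot' {p q r : FreeGroup (Fin 2)} (h : IsConjOrInv (thetaCommutator r p q) freeCommutator) :
      IsConjOrInv (thetaCommutator p q r) freeCommutator := rot (rot h)
  have strip {p q r : FreeGroup (Fin 2)} (hn : p.norm + q.norm + r.norm = n)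
      (hg : ThetaGenerates p q r) {s} (h : (p.toWord.head? = some s ∧ q.toWord.head? = some s) ∨
        (q.toWord.head? = some s ∧ r.toWord.head? = some s) ∨
        (r.toWord.head? = some s ∧ p.toWord.head? = some s)) :
      IsConjOrInv (thetaCommutator p q r) freeCommutator := by
    rcases h with ⟨h1, h2⟩ | ⟨h1, h2⟩ | ⟨h1, h2⟩
    · exact strip₀ hn hg h1 h2
    · exact rot (strip₀ (by omega) hg.rotate h1 h2)
    · exact rot' (strip₀ (by omega) hg.rotate.rotate h1 h2)
  have rose {p r : FreeGroup (Fin 2)} (hn : p.norm + (1 : FreeGroup (Fin 2)).norm + r.norm = n)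
      (hg : ThetaGenerates p 1 r) : IsConjOrInv (thetaCommutator p 1 r) freeCommutator := by
    by_cases h : ∀ u v : FreeGroup (Fin 2), (u = p ∨ u = p⁻¹) → (v = r ∨ v = r⁻¹) → ∀ s,
      u.toWord.head? = some s → v.toWord.head? ≠ some s
    · exact isConjOrInv_of_immersed_rose h hg
    push Not at h
    obtain ⟨u, v, hu, hv, s, hs, hs'⟩ := h
    have hgi := hg.inv
    rw [inv_one] at hgi
    have hci {p r : FreeGroup (Fin 2)} (h : IsConjOrInv (thetaCommutator p⁻¹ 1 r⁻¹) freeCommutator) :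
        IsConjOrInv (thetaCommutator p 1 r) freeCommutator :=
      h.of_isConj (by simpa using isConj_thetaCommutator_inv p 1 r)
    have hcr {p r : FreeGroup (Fin 2)} (h : IsConjOrInv (thetaCommutator p 1 r⁻¹) freeCommutator) :
        IsConjOrInv (thetaCommutator p 1 r) freeCommutator :=
      h.of_isConj_inv (isConj_thetaCommutator_inv_right _ _)
    -- Reversing petals turns the shared first letter into one of the first and third labels, so the
    -- fold applies.
    rcases hu with rfl | rfl <;> rcases hv with rfl | rfl
    · exact strip hn hg (.inr (.inr ⟨hs', hs⟩))
    · exact hcr (strip (by rwa [norm_inv_eq]) hg.inv_right (.inr (.inr ⟨hs', hs⟩)))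
    · refine hci (hcr (strip ?_ hgi.inv_right (.inr (.inr ⟨by rwa [inv_inv], hs⟩))))
      rwa [inv_inv, norm_inv_eq]
    · refine hci (strip ?_ hgi (.inr (.inr ⟨hs', hs⟩)))
      rwa [norm_inv_eq, norm_inv_eq]
  intro p q r hn hg
  by_cases hq : q = 1
  · subst hq; exact rose hn hg
  by_cases hr : r = 1
  · subst hr; exact rot (rose (by omega) hg.rotate)
  by_cases hp : p = 1
  · subst hp; exact rot' (rose (by omega) hg.rotate.rotate)
  let e : Fin 3 → FreeGroup (Fin 2) := ![p, q, r]
  have he : ∀ i, e i ≠ 1 := by intro i; fin_cases i <;> simpa [e]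
  have hs : (∃ i j, i ≠ j ∧ ∃ s, (e i).toWord.head? = some s ∧ (e j).toWord.head? = some s) →
      IsConjOrInv (thetaCommutator p q r) freeCommutator := by
    rintro ⟨i, j, hij, s, h1, h2⟩
    refine strip hn hg (s := s) ?_
    fin_cases i <;> fin_cases j <;> first
      | exact absurd rfl hij
      | exact .inl ⟨h1, h2⟩
      | exact .inl ⟨h2, h1⟩
      | exact .inr (.inl ⟨h1, h2⟩)
      | exact .inr (.inl ⟨h2, h1⟩)
      | exact .inr (.inr ⟨h1, h2⟩)
      | exact .inr (.inr ⟨h2, h1⟩)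
  have hs' : (∃ i j, i ≠ j ∧ ∃ s, (e i)⁻¹.toWord.head? = some s ∧
      (e j)⁻¹.toWord.head? = some s) → IsConjOrInv (thetaCommutator p q r) freeCommutator := by
    rintro ⟨i, j, hij, s, h1, h2⟩
    refine (strip (s := s) ?_ hg.inv ?_).of_isConj (isConj_thetaCommutator_inv _ _ _)
    · simpa only [norm_inv_eq] using hn
    · fin_cases i <;> fin_cases j <;> first
      | exact absurd rfl hij
      | exact .inl ⟨h1, h2⟩
      | exact .inl ⟨h2, h1⟩
      | exact .inr (.inl ⟨h1, h2⟩)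
      | exact .inr (.inl ⟨h2, h1⟩)
      | exact .inr (.inr ⟨h1, h2⟩)
      | exact .inr (.inr ⟨h2, h1⟩)
  -- If no fold is possible at either vertex, the theta graph is immersed.
  by_contra hcon
  refine not_thetaGenerates_of_immersed (e := e) he (fun i j hij s h1 h2 => hcon (hs' ?_))
    (fun i j hij s h1 h2 => hcon (hs ?_)) hg
  · exact ⟨i, j, hij, s, h1, h2⟩
  · exact ⟨i, j, hij, s, by rwa [inv_inv] at h1, h2⟩

/-- An automorphism of the free group of rank two maps the commutator of the generators to a
conjugate of itself or of its inverse. -/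
theorem isConjOrInv_map_freeCommutator (φ : FreeGroup (Fin 2) ≃* FreeGroup (Fin 2)) :
    IsConjOrInv (φ freeCommutator) freeCommutator := by
  have h := isConjOrInv_thetaCommutator _ (φ (of 0)) 1 (φ (of 1)) rfl (by
    intro K h1 h2
    rw [inv_one, mul_one] at h1 h2
    have hK : K.comap φ.toMonoidHom = ⊤ := by
      rw [eq_top_iff, ← FreeGroup.closure_range_of, Subgroup.closure_le]
      rintro _ ⟨i, rfl⟩
      fin_cases i
      exacts [h1, h2]
    rw [eq_top_iff]
    intro x _
    have : φ.symm x ∈ K.comap φ.toMonoidHom := by rw [hK]; trivial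
    simpa using this)
  simpa [thetaCommutator, freeCommutator] using h

end Nielsen

/-! ### The fundamental group of the wedge: generation -/

/-- To prove a property of all paths, it suffices to prove it for small paths. -/
theorem path_induction_of_open_cover {X : Type*} [TopologicalSpace X] {ι : Type*} {c : ι → Set X}
    (hc : ∀ i, IsOpen (c i)) (hcov : ∀ x, ∃ i, x ∈ c i) (P : ∀ {x y : X}, Path x y → Prop)
    (hhom : ∀ {x y : X} {γ γ' : Path x y}, γ.Homotopic γ' → P γ → P γ')
    (htrans : ∀ {x y z : X} {γ : Path x y} {γ' : Path y z}, P γ → P γ' → P (γ.trans γ'))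
    (hsmall : ∀ (i : ι) {x y : X} (γ : Path x y), (∀ t, γ t ∈ c i) → P γ)
    {x y : X} (γ : Path x y) : P γ := by
  obtain ⟨t, t0, tmono, ⟨n, hn⟩, ht⟩ := exists_monotone_Icc_subset_open_cover_unitInterval
    (fun i => (hc i).preimage γ.continuous) (fun s _ => Set.mem_iUnion.2 (hcov (γ s)))
  have hsub (k : ℕ) : P (γ.subpath 0 (t k)) := by
    induction k with
    | zero =>
      obtain ⟨i, hi⟩ := hcov (γ 0)
      refine hsmall i _ fun s => ?_
      have : γ.subpath 0 (t 0) s ∈ Set.range (γ.subpath 0 (t 0)) := ⟨s, rfl⟩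
      rw [Path.range_subpath_of_le _ _ _ t0.ge] at this
      obtain ⟨u, hu, hu'⟩ := this
      rw [← hu', show u = 0 by simpa [t0] using hu]
      exact hi
    | succ k ih =>
      obtain ⟨i, hi⟩ := ht k
      refine hhom ⟨Path.Homotopy.subpathTransSubpath γ 0 (t k) (t (k + 1))⟩
        (htrans ih (hsmall i _ fun s => ?_))
      have : γ.subpath (t k) (t (k + 1)) s ∈ Set.range (γ.subpath (t k) (t (k + 1))) := ⟨s, rfl⟩
      rw [Path.range_subpath_of_le _ _ _ (tmono k.le_succ)] at this
      obtain ⟨u, hu, hu'⟩ := this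
      rw [← hu']
      exact hi hu
  have h1 := hsub n
  rw [hn n le_rfl, Path.subpath_zero_one] at h1
  have key : ∀ {x' y' : X} (hx : x' = x) (hy : y' = y), P (γ.cast hx hy) → P γ := by
    rintro x' y' rfl rfl h; exact h
  exact key _ _ h1

/-! ### Paths in the fundamental groupoid, and words closed up by spokes -/

/-- The morphism of the fundamental groupoid represented by a path. -/
def pathArrow {X : Type*} [TopologicalSpace X] {x y : X} (γ : Path x y) :
    FundamentalGroupoid.mk x ⟶ FundamentalGroupoid.mk y := Path.Homotopic.Quotient.mk γ

section pathArrow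

variable {X : Type*} [TopologicalSpace X]

theorem pathArrow_trans {x y z : X} (γ : Path x y) (γ' : Path y z) :
    pathArrow (γ.trans γ') = pathArrow γ ≫ pathArrow γ' := rfl

theorem pathArrow_symm {x y : X} (γ : Path x y) :
    pathArrow γ.symm = Groupoid.inv (pathArrow γ) := rfl

theorem pathArrow_refl (x : X) : pathArrow (Path.refl x) = 𝟙 _ := rfl

theorem pathArrow_eq_iff {x y : X} {γ γ' : Path x y} :
    pathArrow γ = pathArrow γ' ↔ γ.Homotopic γ' := Path.Homotopic.Quotient.eq

theorem pathArrow_surjective {x y : X} (f : FundamentalGroupoid.mk x ⟶ FundamentalGroupoid.mk y) :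
    ∃ γ : Path x y, pathArrow γ = f := Path.Homotopic.Quotient.mk_surjective f

end pathArrow

/-- The homomorphism from the free group to the fundamental group of the wedge. -/
def wedgeHom : FreeGroup (Fin 2) →* FundamentalGroup Wedge base :=
  FreeGroup.lift ![cls loopA, cls loopB]

theorem wedgeHom_of_zero : wedgeHom (FreeGroup.of 0) = cls loopA := by simp [wedgeHom]

theorem wedgeHom_of_one : wedgeHom (FreeGroup.of 1) = cls loopB := by simp [wedgeHom]

/-- A path from the base point to any point of the wedge. -/
def spoke (x : Wedge) : Path base x where
  toFun s := ⟨(Circle.exp (s * Complex.arg x.1.1), Circle.exp (s * Complex.arg x.1.2)),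
    x.2.imp (fun h => by simp [h]) fun h => by simp [h]⟩
  continuous_toFun := by fun_prop
  source' := by simp [base]
  target' := by ext <;> simp [Circle.exp_arg]

theorem spoke_base : spoke base = Path.refl base := by
  refine Path.ext (funext fun s => Subtype.ext (Prod.ext ?_ ?_)) <;>
  · change Circle.exp (s * Complex.arg (1 : Circle)) = 1
    simp

/-- The path, closed up by spokes, represents a word in the two generators. -/
def IsWord {x y : Wedge} (γ : Path x y) : Prop :=
  (pathArrow (spoke x) ≫ pathArrow γ ≫ Groupoid.inv (pathArrow (spoke y)) :
    FundamentalGroup Wedge base) ∈ wedgeHom.range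

namespace IsWord

theorem congr {x y x' y' : Wedge} {γ : Path x y} {γ' : Path x' y'} (hγ : IsWord γ)
    (h : ∀ t, γ t = γ' t) : IsWord γ' := by
  obtain rfl : x = x' := by simpa using h 0
  obtain rfl : y = y' := by simpa using h 1
  rwa [← show γ = γ' from Path.ext (funext h)]

theorem of_homotopic {x y : Wedge} {γ γ' : Path x y} (h : γ.Homotopic γ') (hγ : IsWord γ) :
    IsWord γ' := by
  rwa [IsWord, ← pathArrow_eq_iff.2 h]

theorem trans {x y z : Wedge} {γ : Path x y} {γ' : Path y z} (h : IsWord γ)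
    (h' : IsWord γ') : IsWord (γ.trans γ') := by
  -- Multiplication of endomorphisms reverses the order of concatenation.
  have := wedgeHom.range.mul_mem h' h
  rw [End.mul_def] at this
  simpa [IsWord, pathArrow_trans] using this

theorem symm {x y : Wedge} {γ : Path x y} (h : IsWord γ) : IsWord γ.symm := by
  have := wedgeHom.range.inv_mem h
  rw [IsWord, pathArrow_symm]
  convert this using 1
  change _ = Groupoid.inv _
  simp [Groupoid.inv_eq_inv]

theorem refl (x : Wedge) : IsWord (Path.refl x) := by
  have := wedgeHom.range.one_mem
  rw [IsWord, pathArrow_refl]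
  convert this using 1
  rw [End.one_def]
  simp

theorem of_loop {γ : Path base base} (h : cls γ ∈ wedgeHom.range) : IsWord γ := by
  rw [IsWord, spoke_base, pathArrow_refl]
  convert h using 1
  simp [Groupoid.inv_eq_inv]
  rfl

theorem mem_range {γ : Path base base} (h : IsWord γ) : cls γ ∈ wedgeHom.range := by
  rw [IsWord, spoke_base, pathArrow_refl] at h
  convert h using 1
  simp [Groupoid.inv_eq_inv]
  rfl

theorem spoke (x : Wedge) : IsWord (spoke x) := by
  have := wedgeHom.range.one_mem
  rw [IsWord, spoke_base, pathArrow_refl]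
  convert this using 1
  rw [End.one_def]
  simp

end IsWord

/-- The line, wrapped around the first circle. -/
def wrapA : C(ℝ, Wedge) := ⟨fun θ => ⟨(Circle.exp θ, 1), Or.inr rfl⟩, by fun_prop⟩

/-- The line, wrapped around the second circle. -/
def wrapB : C(ℝ, Wedge) := ⟨fun θ => ⟨(1, Circle.exp θ), Or.inl rfl⟩, by fun_prop⟩

theorem segment_zero_apply (α : ℝ) (u : unitInterval) : Path.segment 0 α u = u * α := by
  simp [Path.segment_apply, AffineMap.lineMap_apply]

/-- On the line only endpoints matter up to homotopy. By periodicity the segment from `0` to `θ`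
becomes a number of full turns followed by a spoke. -/
theorem isWord_map_of_line (f : C(ℝ, Wedge)) (hp : ∀ θ (k : ℤ), f (θ + k * (2 * Real.pi)) = f θ)
    (hspoke : ∀ θ, ∃ k : ℤ, ∃ α : ℝ, θ = α + k * (2 * Real.pi) ∧
      IsWord ((Path.segment 0 α).map f.continuous))
    (hloop : IsWord ((Path.segment 0 (2 * Real.pi)).map f.continuous))
    {s t : ℝ} (γ : Path s t) : IsWord (γ.map f.continuous) := by
  have hom {s t : ℝ} {γ γ' : Path s t} (h : IsWord (γ.map f.continuous)) :
      IsWord (γ'.map f.continuous) :=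
    h.of_homotopic ((SimplyConnectedSpace.paths_homotopic γ γ').map f)
  have tr {r s t : ℝ} (h : IsWord ((Path.segment r s).map f.continuous))
      (h' : IsWord ((Path.segment s t).map f.continuous)) :
      IsWord ((Path.segment r t).map f.continuous) :=
    hom (γ := (Path.segment r s).trans (Path.segment s t)) (by rw [Path.map_trans]; exact h.trans h')
  have sy {s t : ℝ} (h : IsWord ((Path.segment s t).map f.continuous)) :
      IsWord ((Path.segment t s).map f.continuous) := by
    rw [← Path.segment_symm]; exact h.symm
  have shift {s t : ℝ} (k : ℤ) (h : IsWord ((Path.segment s t).map f.continuous)) :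
      IsWord ((Path.segment (s + k * (2 * Real.pi)) (t + k * (2 * Real.pi))).map f.continuous) := by
    refine h.congr fun u => ?_
    simp only [Path.map_coe, Function.comp_apply, Path.segment_apply]
    rw [← hp _ k]
    congr 1
    simp only [AffineMap.lineMap_apply, vsub_eq_sub, smul_eq_mul, vadd_eq_add]
    ring
  have hk (k : ℤ) : IsWord ((Path.segment 0 (k * (2 * Real.pi))).map f.continuous) := by
    induction k using Int.induction_on with
    | zero => exact (IsWord.refl (f 0)).congr fun u => by simp
    | succ k ih =>
      have h2 := shift k hloop
      have : (2 * Real.pi) + (k : ℤ) * (2 * Real.pi) = ((k + 1 : ℤ) : ℝ) * (2 * Real.pi) := by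
        push_cast; ring
      rw [this, zero_add] at h2
      exact tr ih h2
    | pred k ih =>
      have h2 := shift (-k - 1) hloop
      have : (2 * Real.pi) + ((-k - 1 : ℤ) : ℝ) * (2 * Real.pi) = (-k : ℤ) * (2 * Real.pi) := by
        push_cast; ring
      rw [this, zero_add] at h2
      exact tr ih (sy h2)
  have h0 (θ : ℝ) : IsWord ((Path.segment 0 θ).map f.continuous) := by
    obtain ⟨k, α, rfl, hα⟩ := hspoke θ
    have := shift k hα
    rw [zero_add] at this
    exact tr (hk k) this
  exact hom (tr (sy (h0 s)) (h0 t))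

theorem isWord_wrapA {s t : ℝ} (γ : Path s t) : IsWord (γ.map wrapA.continuous) := by
  refine isWord_map_of_line wrapA (fun θ k => ?_) (fun θ => ?_) ?_ γ
  · ext
    · exact congrArg Subtype.val (Circle.exp_eq_exp.2 ⟨k, rfl⟩)
    · rfl
  · obtain ⟨k, hk⟩ := Circle.exp_eq_exp.1 (Circle.exp_arg (Circle.exp θ)).symm
    refine ⟨k, _, hk, (IsWord.spoke (wrapA θ)).congr fun u => ?_⟩
    refine Subtype.ext (Prod.ext ?_ ?_)
    · change Circle.exp (u * Complex.arg (Circle.exp θ)) = Circle.exp (Path.segment 0 _ u)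
      rw [segment_zero_apply]
    · change Circle.exp (u * Complex.arg (1 : Circle)) = 1
      simp
  · refine (IsWord.of_loop ⟨_, wedgeHom_of_zero⟩).congr fun u => ?_
    refine Subtype.ext (Prod.ext ?_ ?_)
    · change Circle.exp (2 * Real.pi * u) = Circle.exp (Path.segment 0 _ u)
      rw [segment_zero_apply, mul_comm]
    · rfl

theorem isWord_wrapB {s t : ℝ} (γ : Path s t) : IsWord (γ.map wrapB.continuous) := by
  refine isWord_map_of_line wrapB (fun θ k => ?_) (fun θ => ?_) ?_ γ
  · ext
    · rfl
    · exact congrArg Subtype.val (Circle.exp_eq_exp.2 ⟨k, rfl⟩)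
  · obtain ⟨k, hk⟩ := Circle.exp_eq_exp.1 (Circle.exp_arg (Circle.exp θ)).symm
    refine ⟨k, _, hk, (IsWord.spoke (wrapB θ)).congr fun u => ?_⟩
    refine Subtype.ext (Prod.ext ?_ ?_)
    · change Circle.exp (u * Complex.arg (1 : Circle)) = 1
      simp
    · change Circle.exp (u * Complex.arg (Circle.exp θ)) = Circle.exp (Path.segment 0 _ u)
      rw [segment_zero_apply]
  · refine (IsWord.of_loop ⟨_, wedgeHom_of_one⟩).congr fun u => ?_
    refine Subtype.ext (Prod.ext ?_ ?_)
    · rfl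
    · change Circle.exp (2 * Real.pi * u) = Circle.exp (Path.segment 0 _ u)
      rw [segment_zero_apply, mul_comm]

/-- The union of the two coordinate axes. -/
abbrev Cross : Type := {p : ℝ × ℝ // p.1 = 0 ∨ p.2 = 0}

instance : SimplyConnectedSpace Cross :=
  have h : StarConvex ℝ (0 : ℝ × ℝ) (Set.ofPred fun p : ℝ × ℝ => p.1 = 0 ∨ p.2 = 0) := by
    intro p hp a b _ _ _
    rcases hp with hp | hp
    · left; simp [hp]
    · right; simp [hp]
  have : ContractibleSpace Cross := h.contractibleSpace ⟨0, .inl rfl⟩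
  inferInstance

/-- The two axes, wrapped around the two circles. -/
def wrapCross : C(Cross, Wedge) :=
  ⟨fun p => ⟨(Circle.exp p.1.1, Circle.exp p.1.2),
    p.2.imp (fun h => by simp [h]) fun h => by simp [h]⟩, by fun_prop⟩

/-- The first axis. -/
def axisA : C(ℝ, Cross) := ⟨fun s => ⟨(s, 0), .inr rfl⟩, by fun_prop⟩

/-- The second axis. -/
def axisB : C(ℝ, Cross) := ⟨fun s => ⟨(0, s), .inl rfl⟩, by fun_prop⟩

/-- The cross is simply connected, so a path may be replaced by one that runs along the axes through
the centre. -/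
theorem isWord_wrapCross {p q : Cross} (γ : Path p q) : IsWord (γ.map wrapCross.continuous) := by
  have h0 (p : Cross) : ∃ δ : Path (⟨0, .inl rfl⟩ : Cross) p, IsWord (δ.map wrapCross.continuous) := by
    obtain ⟨⟨s, t⟩, h⟩ := p
    rcases h with h | h
    · obtain rfl : s = 0 := h
      refine ⟨(Path.segment 0 t).map axisB.continuous, (isWord_wrapB (Path.segment 0 t)).congr
        fun u => ?_⟩
      refine Subtype.ext (Prod.ext ?_ rfl)
      exact Circle.exp_zero.symm
    · obtain rfl : t = 0 := h
      refine ⟨(Path.segment 0 s).map axisA.continuous, (isWord_wrapA (Path.segment 0 s)).congr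
        fun u => ?_⟩
      refine Subtype.ext (Prod.ext rfl ?_)
      exact Circle.exp_zero.symm
  obtain ⟨δ, hδ⟩ := h0 p
  obtain ⟨δ', hδ'⟩ := h0 q
  refine IsWord.of_homotopic ((SimplyConnectedSpace.paths_homotopic (δ.symm.trans δ') γ).map
    wrapCross) ?_
  rw [Path.map_trans]
  exact hδ.symm.trans hδ'

theorem isWord {x y : Wedge} (γ : Path x y) : IsWord γ := by
  -- A path in either of the first two sets stays on one circle and lifts to the line. In the third
  -- set both arguments are continuous, so the path lifts to the cross.
  let c : Fin 3 → Set Wedge := ![{q | q.1.1 ≠ 1}, {q | q.1.2 ≠ 1},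
    {q | (q.1.1 : ℂ) ∈ Complex.slitPlane ∧ (q.1.2 : ℂ) ∈ Complex.slitPlane}]
  have hc : ∀ i, IsOpen (c i) := by
    intro i
    fin_cases i
    · exact isOpen_ne_fun (by fun_prop) (by fun_prop)
    · exact isOpen_ne_fun (by fun_prop) (by fun_prop)
    · exact (Complex.isOpen_slitPlane.preimage (by fun_prop)).inter
        (Complex.isOpen_slitPlane.preimage (by fun_prop))
  have hcov : ∀ q : Wedge, ∃ i, q ∈ c i := by
    intro q
    by_cases h1 : q.1.1 = 1
    · by_cases h2 : q.1.2 = 1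
      · exact ⟨2, by simp [c, h1, h2]⟩
      · exact ⟨1, h2⟩
    · exact ⟨0, h1⟩
  refine path_induction_of_open_cover hc hcov IsWord IsWord.of_homotopic IsWord.trans ?_ γ
  intro i x y γ hγ
  fin_cases i
  · have h2 (t) : (γ t).1.2 = 1 := (γ t).2.resolve_left (hγ t)
    obtain ⟨θ, hθ⟩ := exists_lift_exp (γ.map (f := fun q : Wedge => q.1.1) (by fun_prop))
    refine (isWord_wrapA ⟨θ, rfl, rfl⟩).congr fun t => Subtype.ext (Prod.ext (hθ t) (h2 t).symm)
  · have h2 (t) : (γ t).1.1 = 1 := (γ t).2.resolve_right (hγ t)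
    obtain ⟨θ, hθ⟩ := exists_lift_exp (γ.map (f := fun q : Wedge => q.1.2) (by fun_prop))
    refine (isWord_wrapB ⟨θ, rfl, rfl⟩).congr fun t => Subtype.ext (Prod.ext (h2 t).symm (hθ t))
  · let δ : C(unitInterval, Cross) := ⟨fun t => ⟨(Complex.arg (γ t).1.1, Complex.arg (γ t).1.2),
      (γ t).2.imp (fun h => by simp [h]) fun h => by simp [h]⟩, by
        refine Continuous.subtype_mk (Continuous.prodMk ?_ ?_) _ <;>
        refine continuous_iff_continuousAt.2 fun t => ?_
        · exact (Complex.continuousAt_arg (hγ t).1).comp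
            (f := fun t => ((γ t).1.1 : ℂ)) (by fun_prop)
        · exact (Complex.continuousAt_arg (hγ t).2).comp
            (f := fun t => ((γ t).1.2 : ℂ)) (by fun_prop)⟩
    refine (isWord_wrapCross ⟨δ, rfl, rfl⟩).congr fun t => ?_
    exact Subtype.ext (Prod.ext (Circle.exp_arg _) (Circle.exp_arg _))

theorem wedgeHom_surjective : Function.Surjective wedgeHom := by
  intro g
  obtain ⟨γ, rfl⟩ := pathArrow_surjective g
  exact (isWord γ).mem_range

/-! ### The universal cover of the wedge -/

section UniversalCover

open Filter Topology

instance : TopologicalSpace (FreeGroup (Fin 2)) := ⊥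

instance : DiscreteTopology (FreeGroup (Fin 2)) := ⟨rfl⟩

/-- The coordinate change of the universal cover of the wedge. -/
def transition (x : Wedge) : FreeGroup (Fin 2) :=
  if (x.1.1 : ℂ).im < 0 then .of 0 else if (x.1.2 : ℂ).im < 0 then .of 1 else 1

theorem im_ne_zero_of_ne {z : Circle} (h : z ≠ 1) (h' : z ≠ -1) : (z : ℂ).im ≠ 0 := by
  intro h0
  have h1 := z.normSq_coe
  rw [Complex.normSq_apply, h0, mul_zero, add_zero] at h1
  rcases mul_self_eq_one_iff.1 h1 with h2 | h2
  · exact h (Circle.ext (Complex.ext (by simpa using h2) (by simpa using h0)))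
  · exact h' (Circle.ext (Complex.ext (by simpa using h2) (by simpa using h0)))

/-- The excluded points are those where both imaginary parts vanish. What remains is four open
half-circles, on each of which `transition` is constant. -/
theorem transition_continuousAt {x : Wedge} (h : x ≠ base) (h1 : x.1.1 ≠ -1) (h2 : x.1.2 ≠ -1) :
    ContinuousAt transition x := by
  have c1 : Continuous fun y : Wedge => (y.1.1 : ℂ).im := by fun_prop
  have c2 : Continuous fun y : Wedge => (y.1.2 : ℂ).im := by fun_prop
  have z1 (y : Wedge) (hy : (y.1.1 : ℂ).im ≠ 0) : (y.1.2 : ℂ).im = 0 := by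
    rcases y.2 with h | h
    · rw [h] at hy; simp at hy
    · simp [h]
  have z2 (y : Wedge) (hy : (y.1.2 : ℂ).im ≠ 0) : (y.1.1 : ℂ).im = 0 := by
    by_contra h; exact hy (z1 y h)
  have key : ∃ U : Set Wedge, IsOpen U ∧ x ∈ U ∧ ∃ v, ∀ y ∈ U, transition y = v := by
    have hne : (x.1.1 : ℂ).im ≠ 0 ∨ (x.1.2 : ℂ).im ≠ 0 := by
      by_cases e1 : x.1.1 = 1
      · refine .inr (im_ne_zero_of_ne (fun e2 => h (Subtype.ext (Prod.ext e1 e2))) h2)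
      · exact .inl (im_ne_zero_of_ne e1 h1)
    rcases hne with h0 | h0 <;> rcases h0.lt_or_gt with h0 | h0
    · exact ⟨_, isOpen_lt c1 continuous_const, h0, .of 0, fun y (hy : _ < _) => if_pos hy⟩
    · refine ⟨_, isOpen_lt continuous_const c1, h0, 1, fun y hy => ?_⟩
      rw [Set.mem_ofPred_eq] at hy
      rw [transition, if_neg hy.not_gt, if_neg (z1 y hy.ne').not_lt]
    · refine ⟨_, isOpen_lt c2 continuous_const, h0, .of 1, fun y hy => ?_⟩
      rw [Set.mem_ofPred_eq] at hy
      rw [transition, if_neg (z2 y hy.ne).not_lt, if_pos hy]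
    · refine ⟨_, isOpen_lt continuous_const c2, h0, 1, fun y hy => ?_⟩
      rw [Set.mem_ofPred_eq] at hy
      rw [transition, if_neg (z2 y hy.ne').not_lt, if_neg hy.not_gt]
  obtain ⟨U, hU, hx, v, hv⟩ := key
  exact (continuousAt_const (y := v)).congr
    (eventually_of_mem (hU.mem_nhds hx) fun y hy => (hv y hy).symm)

open Classical in
/-- The universal cover of the wedge, as a bundle with fibre the free group. -/
def universalCover : FiberBundleCore Bool Wedge (FreeGroup (Fin 2)) where
  baseSet i := {x | if i then x.1.1 ≠ -1 ∧ x.1.2 ≠ -1 else x ≠ base}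
  isOpen_baseSet i := by
    cases i
    · simpa using! isOpen_ne
    · simpa using! (isOpen_ne_fun (by fun_prop) (by fun_prop)).inter
        (isOpen_ne_fun (by fun_prop) (by fun_prop))
  indexAt x := decide (x = base)
  mem_baseSet_at x := by
    by_cases h : x = base
    · have : (1 : Circle) ≠ -1 := fun h => by
        have := congrArg (fun z : Circle => (z : ℂ).re) h
        norm_num at this
      simp [h, base, this]
    · simp [h]
  -- Chart `true` surrounds the vertex and chart `false` omits it. The gluing is left multiplication
  -- by a generator on the lower half of each circle and trivial on the upper halves.
  coordChange i j x v := (if j then transition x else 1) * (if i then transition x else 1)⁻¹ * v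
  coordChange_self i x _ v := by simp
  continuousOn_coordChange i j := by
    cases i <;> cases j
    · simpa using! continuousOn_snd
    · rintro ⟨x, v⟩ ⟨⟨h1, h2⟩, -⟩
      simp only [Bool.false_eq_true, if_false, if_true, Set.mem_ofPred_eq] at h1 h2
      refine ContinuousAt.continuousWithinAt ?_
      simpa using! (ContinuousAt.comp (g := transition)
        (f := Prod.fst) (x := (x, v)) (transition_continuousAt h1 h2.1 h2.2) continuousAt_fst).mul continuousAt_snd
    · rintro ⟨x, v⟩ ⟨⟨h2, h1⟩, -⟩
      simp only [Bool.false_eq_true, if_false, if_true, Set.mem_ofPred_eq] at h1 h2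
      refine ContinuousAt.continuousWithinAt ?_
      simpa using! (ContinuousAt.comp (g := transition)
        (f := Prod.fst) (x := (x, v)) (transition_continuousAt h1 h2.1 h2.2) continuousAt_fst).inv.mul
        continuousAt_snd
    · simpa using! continuousOn_snd
  coordChange_comp i j k x _ v := by group

theorem isCoveringMap_universalCover :
    IsCoveringMap (Bundle.TotalSpace.proj : universalCover.TotalSpace → Wedge) :=
  FiberBundle.isCoveringMap (F := FreeGroup (Fin 2)) (E := universalCover.Fiber)

/-- The point of the universal cover over `x` with coordinate `v`. -/
def coverPoint (x : Wedge) (v : FreeGroup (Fin 2)) : universalCover.TotalSpace := ⟨x, v⟩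

theorem coverPoint_injective (x : Wedge) : Function.Injective (coverPoint x) := by
  intro v v' h
  injection h

-- The coordinate is read in the preferred chart, which is the vertex chart only over `base`. The
-- jump from `v` to `g * v` at `t = 1` is thus just the change of chart along the last arc; on the
-- first arc the transition is trivial.
open Classical in
theorem universalCover_continuous_lift (γ : Path base base) (g v : FreeGroup (Fin 2))
    (h : ∀ t, t ≠ 0 → t ≠ 1 → γ t ≠ base)
    (h0 : ∀ᶠ t in 𝓝 (0 : unitInterval), transition (γ t) = 1)
    (h1 : ∀ᶠ t in 𝓝 (1 : unitInterval), t ≠ 1 → transition (γ t) = g) :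
    Continuous fun t : unitInterval =>
      coverPoint (γ t) (if t = 1 then g * v else v) := by
  have hs (b x : Wedge) (w : FreeGroup (Fin 2)) : (universalCover.localTrivAt b (coverPoint x w)).2 =
      (if b = base then transition x else 1) * (if x = base then transition x else 1)⁻¹ * w := by
    rw [FiberBundleCore.localTrivAt_snd]
    change (if decide (b = base) then transition x else 1) *
      (if decide (x = base) then transition x else 1)⁻¹ * w = _
    simp
  refine continuous_iff_continuousAt.2 fun t₀ => ?_
  refine (FiberBundle.continuousAt_totalSpace (F := FreeGroup (Fin 2))
    (E := universalCover.Fiber) _).2 ⟨γ.continuous.continuousAt, ?_⟩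
  change ContinuousAt (fun t => (universalCover.localTrivAt (γ t₀) (coverPoint (γ t) _)).2) t₀
  simp only [hs]
  by_cases e0 : t₀ = 0
  · subst e0
    refine (continuousAt_const (y := v)).congr ?_
    filter_upwards [h0, isOpen_ne.mem_nhds (zero_ne_one (α := unitInterval))] with t ht ht1
    simp [ht, ht1]
  by_cases e1 : t₀ = 1
  · subst e1
    refine (continuousAt_const (y := g * v)).congr ?_
    filter_upwards [h1, isOpen_ne.mem_nhds (zero_ne_one (α := unitInterval)).symm] with t ht ht0
    by_cases ht1 : t = 1
    · simp [ht1]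
    · simp [ht1, ht ht1, h t ht0 ht1]
  · refine (continuousAt_const (y := v)).congr ?_
    filter_upwards [isOpen_ne.mem_nhds e0, isOpen_ne.mem_nhds e1] with t ht0 ht1
    simp [h t ht0 ht1, h t₀ e0 e1, ht1]

/-- The point of the universal cover over the base point with coordinate `v`. -/
def fibrePoint (v : FreeGroup (Fin 2)) :
    (Bundle.TotalSpace.proj : universalCover.TotalSpace → Wedge) ⁻¹' {base} := ⟨coverPoint base v, rfl⟩

theorem monodromy_loop (γ : Path base base) (g v : FreeGroup (Fin 2))
    (h : ∀ t, t ≠ 0 → t ≠ 1 → γ t ≠ base)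
    (h0 : ∀ᶠ t in 𝓝 (0 : unitInterval), transition (γ t) = 1)
    (h1 : ∀ᶠ t in 𝓝 (1 : unitInterval), t ≠ 1 → transition (γ t) = g) :
    isCoveringMap_universalCover.monodromyPerm base (cls γ) (fibrePoint v) = fibrePoint (g * v) := by
  classical
  have e0 : coverPoint (γ 0) (if (0 : unitInterval) = 1 then g * v else v) =
      (fibrePoint v).1 := by
    rw [if_neg zero_ne_one, γ.source]; rfl
  have e1 : coverPoint (γ 1) (if (1 : unitInterval) = 1 then g * v else v) =
      (fibrePoint (g * v)).1 := by
    rw [if_pos rfl, γ.target]; rfl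
  let Γ : Path (fibrePoint v).1 (fibrePoint (g * v)).1 :=
    ⟨⟨_, universalCover_continuous_lift γ g v h h0 h1⟩, e0, e1⟩
  exact isCoveringMap_universalCover.monodromy_eq_of_map_eq (γ := .mk γ) (.mk Γ) rfl

theorem exp_ne_one {t : unitInterval} (h0 : t ≠ 0) (h1 : t ≠ 1) :
    Circle.exp (2 * Real.pi * t) ≠ 1 := by
  intro h
  rw [← Circle.exp_zero, Circle.exp_eq_exp] at h
  obtain ⟨k, hk⟩ := h
  have hk' : (t : ℝ) = k := by
    have := Real.pi_pos
    exact mul_left_cancel₀ (by positivity : (2 * Real.pi) ≠ 0) (by linarith)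
  have p0 : (0 : ℝ) < t := lt_of_le_of_ne t.2.1 fun e => h0 (Subtype.ext e.symm)
  have p1 : (t : ℝ) < 1 := lt_of_le_of_ne t.2.2 fun e => h1 (Subtype.ext e)
  rw [hk'] at p0 p1
  norm_cast at p0 p1
  omega

theorem eventually_im_exp_nonneg :
    ∀ᶠ t : unitInterval in 𝓝 0, ¬ (Circle.exp (2 * Real.pi * t) : ℂ).im < 0 := by
  have : ∀ᶠ t : unitInterval in 𝓝 0, (t : ℝ) < 1 / 2 :=
    (isOpen_lt continuous_subtype_val continuous_const).mem_nhds (by norm_num)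
  filter_upwards [this] with t ht
  rw [Circle.coe_exp, Complex.exp_ofReal_mul_I_im, not_lt]
  exact Real.sin_nonneg_of_nonneg_of_le_pi (by have := t.2.1; positivity)
    (by nlinarith [Real.pi_pos])

theorem eventually_im_exp_neg :
    ∀ᶠ t : unitInterval in 𝓝 1, t ≠ 1 → (Circle.exp (2 * Real.pi * t) : ℂ).im < 0 := by
  have : ∀ᶠ t : unitInterval in 𝓝 1, 1 / 2 < (t : ℝ) :=
    (isOpen_lt continuous_const continuous_subtype_val).mem_nhds (by norm_num)
  filter_upwards [this] with t ht h1
  have p1 : (t : ℝ) < 1 := lt_of_le_of_ne t.2.2 fun e => h1 (Subtype.ext e)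
  rw [Circle.coe_exp, Complex.exp_ofReal_mul_I_im, ← Real.sin_sub_two_pi]
  exact Real.sin_neg_of_neg_of_neg_pi_lt (by nlinarith [Real.pi_pos]) (by nlinarith [Real.pi_pos])

theorem monodromy_loopA (v : FreeGroup (Fin 2)) :
    isCoveringMap_universalCover.monodromyPerm base (cls loopA) (fibrePoint v) =
      fibrePoint (.of 0 * v) := by
  refine monodromy_loop loopA _ v (fun t h0 h1 h => exp_ne_one h0 h1 (congrArg (·.1.1) h)) ?_ ?_
  · filter_upwards [eventually_im_exp_nonneg] with t ht
    exact (if_neg ht).trans (if_neg (show ¬ ((1 : Circle) : ℂ).im < 0 by simp))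
  · filter_upwards [eventually_im_exp_neg] with t ht h1
    exact if_pos (ht h1)

theorem monodromy_loopB (v : FreeGroup (Fin 2)) :
    isCoveringMap_universalCover.monodromyPerm base (cls loopB) (fibrePoint v) =
      fibrePoint (.of 1 * v) := by
  refine monodromy_loop loopB _ v (fun t h0 h1 h => exp_ne_one h0 h1 (congrArg (·.1.2) h)) ?_ ?_
  · filter_upwards [eventually_im_exp_nonneg] with t ht
    exact (if_neg (show ¬ ((1 : Circle) : ℂ).im < 0 by simp)).trans (if_neg ht)
  · filter_upwards [eventually_im_exp_neg] with t ht h1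
    exact (if_neg (show ¬ ((1 : Circle) : ℂ).im < 0 by simp)).trans (if_pos (ht h1))

/-- The monodromy on the fibre is the left regular action, so a word is recovered from its effect on
the point with coordinate `1`. -/
theorem monodromy_wedgeHom (w v : FreeGroup (Fin 2)) :
    isCoveringMap_universalCover.monodromyPerm base (wedgeHom w) (fibrePoint v) =
      fibrePoint (w * v) := by
  have hof (i : Fin 2) (v) : isCoveringMap_universalCover.monodromyPerm base
      (wedgeHom (.of i)) (fibrePoint v) = fibrePoint (.of i * v) := by
    fin_cases i
    · exact (congrArg (fun g => isCoveringMap_universalCover.monodromyPerm base g (fibrePoint v))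
        wedgeHom_of_zero).trans (monodromy_loopA v)
    · exact (congrArg (fun g => isCoveringMap_universalCover.monodromyPerm base g (fibrePoint v))
        wedgeHom_of_one).trans (monodromy_loopB v)
  induction w using FreeGroup.induction_on generalizing v with
  | C1 => rw [map_one, map_one, one_mul]; rfl
  | of i => exact hof i v
  | inv_of i _ =>
    rw [map_inv, map_inv, Equiv.Perm.inv_eq_iff_eq, hof, mul_inv_cancel_left]
  | mul a b ha hb =>
    rw [map_mul, map_mul, Equiv.Perm.mul_apply, hb, ha, mul_assoc]

theorem wedgeHom_injective : Function.Injective wedgeHom := by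
  intro w w' h
  have h1 := monodromy_wedgeHom w 1
  rw [h, monodromy_wedgeHom w' 1, mul_one, mul_one] at h1
  exact (coverPoint_injective base (congrArg Subtype.val h1)).symm

/-- The fundamental group of the wedge is free on the two loops. -/
def wedgeEquiv : FreeGroup (Fin 2) ≃* FundamentalGroup Wedge base :=
  MulEquiv.ofBijective wedgeHom ⟨wedgeHom_injective, wedgeHom_surjective⟩

end UniversalCover

/-! ### The fundamental group and the first homology of the wedge -/

theorem cls_trans (γ γ' : Path base base) : cls (γ.trans γ') = cls γ' * cls γ := rfl

theorem cls_symm (γ : Path base base) : cls γ.symm = (cls γ)⁻¹ := rfl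

theorem cls_eq_iff {γ γ' : Path base base} : cls γ = cls γ' ↔ γ.Homotopic γ' :=
  Path.Homotopic.Quotient.eq

theorem cls_surjective : Function.Surjective cls := Path.Homotopic.Quotient.mk_surjective

theorem wedgeEquiv_apply (w : FreeGroup (Fin 2)) : wedgeEquiv w = wedgeHom w := rfl

/-- The reversed product order turns the loop `a b a⁻¹ b⁻¹` into the element `b⁻¹ a⁻¹ b a`, whence
the inverse. -/
theorem isConj_cls_commLoop : IsConj (cls commLoop) (wedgeEquiv freeCommutator⁻¹) := by
  have h : cls commLoop = wedgeEquiv ((.of 1)⁻¹ * ((.of 0)⁻¹ * (.of 1 * .of 0))) := by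
    rw [wedgeEquiv_apply]
    simp only [commLoop, cls_trans, cls_symm, map_mul, map_inv, wedgeHom_of_zero, wedgeHom_of_one]
  rw [h]
  refine MonoidHom.map_isConj wedgeEquiv.toMonoidHom (isConj_iff.2 ⟨.of 1 * .of 0, ?_⟩)
  rw [freeCommutator]
  group

/-- Automorphisms of the fundamental group of the wedge preserve the commutator up to conjugation
and inversion. -/
theorem isConjOrInv_map_commLoop
    (φ : FundamentalGroup Wedge base ≃* FundamentalGroup Wedge base) :
    IsConjOrInv (φ (cls commLoop)) (cls commLoop) := by
  have h := isConjOrInv_map_freeCommutator ((wedgeEquiv.trans φ).trans wedgeEquiv.symm)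
  have h2 : IsConjOrInv (φ (wedgeEquiv freeCommutator)) (wedgeEquiv freeCommutator) := by
    refine h.imp (fun h => ?_) fun h => ?_
    · simpa using! MonoidHom.map_isConj wedgeEquiv.toMonoidHom h
    · simpa using! MonoidHom.map_isConj wedgeEquiv.toMonoidHom h
  have h3 := isConj_cls_commLoop
  have h4 := MonoidHom.map_isConj φ.toMonoidHom h3
  rw [map_inv] at h3
  have h5 : IsConj (φ (cls commLoop)) (φ (wedgeEquiv freeCommutator))⁻¹ := by simpa using! h4
  refine IsConjOrInv.of_isConj_inv h5 (h2.symm.imp (fun h => h.trans h3.symm) fun h => h.trans ?_)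
  simpa using isConj_inv_inv h3.symm

/-! ### Winding numbers and homology of the wedge -/

/-- The first coordinate. -/
def coordA : C(Wedge, Circle) := ⟨fun x => x.1.1, by fun_prop⟩

/-- The second coordinate. -/
def coordB : C(Wedge, Circle) := ⟨fun x => x.1.2, by fun_prop⟩

/-- The winding numbers of the coordinates of a path. -/
def windings {x y : Wedge} (γ : Path x y) : ℤ × ℤ :=
  (winding (γ.map coordA.continuous), winding (γ.map coordB.continuous))

theorem windings_trans {x y z : Wedge} (γ : Path x y) (γ' : Path y z) :
    windings (γ.trans γ') = windings γ + windings γ' := by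
  simp [windings, Path.map_trans, winding_trans]

theorem windings_symm {x y : Wedge} (γ : Path x y) : windings γ.symm = - windings γ :=
  Prod.ext (winding_symm (γ.map coordA.continuous)) (winding_symm (γ.map coordB.continuous))

theorem windings_refl (x : Wedge) : windings (Path.refl x) = 0 :=
  Prod.ext (winding_refl (coordA x)) (winding_refl (coordB x))

theorem windings_eq_of_homotopic {x y : Wedge} {γ γ' : Path x y} (h : γ.Homotopic γ') :
    windings γ = windings γ' :=
  Prod.ext (winding_eq_of_homotopic (h.map coordA)) (winding_eq_of_homotopic (h.map coordB))

theorem turns_zero : turns 0 = 0 := by simp [turns]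

theorem turns_two_pi : turns (2 * Real.pi) = 1 := by
  simpa [turns_zero] using turns_add 0 1

theorem winding_exp {x y : Circle} (γ : Path x y)
    (h : ∀ t, γ t = Circle.exp (2 * Real.pi * t)) : winding γ = 1 := by
  rw [winding_eq γ ⟨fun t => 2 * Real.pi * t, by fun_prop⟩ fun t => (h t).symm]
  simp [turns_zero, turns_two_pi]

theorem winding_const {x y : Circle} (γ : Path x y) (h : ∀ t, γ t = x) : winding γ = 0 := by
  rw [winding_congr (γ' := Path.refl x) h, winding_refl]

theorem windings_loopA : windings loopA = (1, 0) :=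
  Prod.ext (winding_exp _ fun _ => rfl) (winding_const _ fun _ => rfl)

theorem windings_loopB : windings loopB = (0, 1) :=
  Prod.ext (winding_const _ fun _ => rfl) (winding_exp _ fun _ => rfl)

theorem windings_commLoop : windings commLoop = 0 := by
  rw [commLoop, windings_trans, windings_trans, windings_trans, windings_symm, windings_symm]
  abel

/-- The first homology class of a loop is determined by its winding numbers. -/
theorem loopClass_eq_windings (R : Type) [CommRing R] (γ : Path base base) :
    loopClass R γ = ((windings γ).1 : R) • loopClass R loopA +
      ((windings γ).2 : R) • loopClass R loopB := by
  suffices h : ∀ (w : FreeGroup (Fin 2)) (γ : Path base base), cls γ = wedgeHom w →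
      loopClass R γ = ((windings γ).1 : R) • loopClass R loopA +
        ((windings γ).2 : R) • loopClass R loopB by
    obtain ⟨w, hw⟩ := wedgeHom_surjective (cls γ)
    exact h w γ hw.symm
  have hof (i : Fin 2) (γ : Path base base) (hγ : cls γ = wedgeHom (.of i)) :
      loopClass R γ = ((windings γ).1 : R) • loopClass R loopA +
        ((windings γ).2 : R) • loopClass R loopB := by
    fin_cases i
    · have := cls_eq_iff.1 (hγ.trans wedgeHom_of_zero)
      rw [loopClass_eq_of_homotopic R this, windings_eq_of_homotopic this, windings_loopA]
      simp
    · have := cls_eq_iff.1 (hγ.trans wedgeHom_of_one)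
      rw [loopClass_eq_of_homotopic R this, windings_eq_of_homotopic this, windings_loopB]
      simp
  intro w
  induction w using FreeGroup.induction_on with
  | C1 =>
    intro γ hγ
    have : γ.Homotopic (.refl base) := cls_eq_iff.1 (hγ.trans (map_one _))
    rw [loopClass_eq_of_homotopic R this, windings_eq_of_homotopic this, windings_refl,
      loopClass_refl]
    simp
  | of i => exact hof i
  | inv_of i _ =>
    intro γ hγ
    have h := hof i γ.symm (by rw [cls_symm, hγ, map_inv, inv_inv])
    rw [loopClass_symm, windings_symm] at h
    rw [← neg_neg (loopClass R γ), h]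
    simp
    abel
  | mul v w hv hw =>
    intro γ hγ
    obtain ⟨α, hα⟩ := cls_surjective (wedgeHom w)
    obtain ⟨β, hβ⟩ := cls_surjective (wedgeHom v)
    have : γ.Homotopic (α.trans β) :=
      cls_eq_iff.1 (by rw [hγ, cls_trans, hα, hβ, map_mul])
    rw [loopClass_eq_of_homotopic R this, windings_eq_of_homotopic this, windings_trans,
      loopClass_trans, hw _ hα, hv _ hβ]
    simp only [Prod.fst_add, Prod.snd_add, Int.cast_add, add_smul]
    abel

instance : PathConnectedSpace Wedge where
  nonempty := ⟨base⟩
  joined x y := ⟨(spoke x).symm.trans (spoke y)⟩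

/-- The degrees of the two coordinate maps detect the parities. Conversely, a spoke moves the loop
to `base`, where its class is a combination of the two generators with the winding numbers as
coefficients. -/
theorem loopClass_zmod_two_eq_zero_iff {x : Wedge} (γ : Path x x) :
    loopClass (ZMod 2) γ = 0 ↔ Even (windings γ).1 ∧ Even (windings γ).2 := by
  constructor
  · intro h
    have h1 := winding_eq_zero_of_loopClass (ZMod 2) coordA γ h
    have h2 := winding_eq_zero_of_loopClass (ZMod 2) coordB γ h
    exact ⟨ZMod.intCast_eq_zero_iff_even.1 h1, ZMod.intCast_eq_zero_iff_even.1 h2⟩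
  · intro h
    have h3 : windings (((spoke x).trans γ).trans (spoke x).symm) = windings γ := by
      rw [windings_trans, windings_trans, windings_symm]; abel
    rw [← loopClass_conj (ZMod 2) (spoke x) γ, loopClass_eq_windings, h3,
      ZMod.intCast_eq_zero_iff_even.2 h.1, ZMod.intCast_eq_zero_iff_even.2 h.2, zero_smul,
      zero_smul, add_zero]

/-! ### The cover -/

theorem circle_sq_surjective (z : Circle) : ∃ w : Circle, w ^ 2 = z :=
  ⟨Circle.exp (Complex.arg z / 2), by
    rw [← Circle.exp_nsmul, nsmul_eq_mul, Nat.cast_ofNat, mul_div_cancel₀ _ (by norm_num : (2 : ℝ) ≠ 0),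
      Circle.exp_arg]⟩

theorem circle_sq_eq_sq {z w : Circle} (h : z ^ 2 = w ^ 2) : z = w ∨ z = -w := by
  have h' : (z : ℂ) ^ 2 = (w : ℂ) ^ 2 := by exact_mod_cast congrArg (Subtype.val : Circle → ℂ) h
  rcases sq_eq_sq_iff_eq_or_eq_neg.1 h' with h | h
  · exact .inl (Circle.ext h)
  · exact .inr (Circle.ext h)

theorem finite_circle_sq_eq (x : Circle) : (Set.ofPred fun z : Circle => z ^ 2 = x).Finite := by
  obtain ⟨w, rfl⟩ := circle_sq_surjective x
  exact (Set.toFinite {w, -w}).subset fun z hz => circle_sq_eq_sq hz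

/-- The squaring map of the torus. -/
def torusSq : Circle × Circle →* Circle × Circle := powMonoidHom 2

/-- A continuous surjective homomorphism from a compact group to a Hausdorff group is a quotient
map; its kernel here is finite, hence discrete. -/
theorem isCoveringMap_torusSq : IsCoveringMap torusSq := by
  have hs : Function.Surjective torusSq := by
    rintro ⟨z, w⟩
    obtain ⟨z', hz⟩ := circle_sq_surjective z
    obtain ⟨w', hw⟩ := circle_sq_surjective w
    exact ⟨(z', w'), Prod.ext hz hw⟩
  have hc : Continuous torusSq := continuous_pow 2
  have hf : (torusSq.ker : Set (Circle × Circle)).Finite := by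
    refine ((finite_circle_sq_eq 1).prod (finite_circle_sq_eq 1)).subset fun z hz => ?_
    exact ⟨congrArg Prod.fst hz, congrArg Prod.snd hz⟩
  exact ((hc.isClosedMap.isQuotientMap hc hs).isQuotientCoveringMap_of_isDiscrete_ker_monoidHom
    hf.isDiscrete).isCoveringMap

theorem isCoveringMap_proj : IsCoveringMap proj :=
  isCoveringMap_torusSq.restrictPreimage (Set.ofPred fun q => q.1 = 1 ∨ q.2 = 1)

theorem proj_surjective : Function.Surjective proj := by
  rintro ⟨⟨z, w⟩, h⟩
  obtain ⟨z', rfl⟩ := circle_sq_surjective z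
  obtain ⟨w', rfl⟩ := circle_sq_surjective w
  exact ⟨⟨(z', w'), h⟩, rfl⟩

theorem finite_proj_fibre (x : Wedge) : (proj ⁻¹' {x}).Finite := by
  refine Set.Finite.of_finite_image (f := Subtype.val) ?_ Subtype.val_injective.injOn
  refine ((finite_circle_sq_eq x.1.1).prod (finite_circle_sq_eq x.1.2)).subset ?_
  rintro _ ⟨z, hz, rfl⟩
  exact ⟨congrArg (fun x : Wedge => x.1.1) hz, congrArg (fun x : Wedge => x.1.2) hz⟩

theorem cover_joined_one (q : Cover) : Joined q ⟨(1, 1), .inl (one_pow 2)⟩ := by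
  have hA {w : Circle} (hw : w ^ 2 = 1) (z z' : Circle) :
      Joined (⟨(z, w), .inr hw⟩ : Cover) ⟨(z', w), .inr hw⟩ :=
    (PathConnectedSpace.joined z z').map (f := fun z => (⟨(z, w), .inr hw⟩ : Cover)) (by fun_prop)
  have hB {z : Circle} (hz : z ^ 2 = 1) (w w' : Circle) :
      Joined (⟨(z, w), .inl hz⟩ : Cover) ⟨(z, w'), .inl hz⟩ :=
    (PathConnectedSpace.joined w w').map (f := fun w => (⟨(z, w), .inl hz⟩ : Cover)) (by fun_prop)
  obtain ⟨⟨z, w⟩, h⟩ := q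
  rcases h with h | h
  · exact (hB h w 1).trans (hA (one_pow 2) z 1)
  · exact (hA h z 1).trans (hB (one_pow 2) w 1)

instance : PathConnectedSpace Cover where
  nonempty := ⟨⟨(1, 1), .inl (one_pow 2)⟩⟩
  joined x y := (cover_joined_one x).trans (cover_joined_one y).symm

/-- Translation by an element of order two, as a deck transformation. -/
def deck (u : Circle × Circle) (hu : u ^ 2 = 1) : Cover ≃ₜ Cover where
  toFun q := ⟨u * q.1, by
    have h1 : u.1 ^ 2 = 1 := congrArg Prod.fst hu
    have h2 : u.2 ^ 2 = 1 := congrArg Prod.snd hu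
    simpa [mul_pow, h1, h2] using q.2⟩
  invFun q := ⟨u * q.1, by
    have h1 : u.1 ^ 2 = 1 := congrArg Prod.fst hu
    have h2 : u.2 ^ 2 = 1 := congrArg Prod.snd hu
    simpa [mul_pow, h1, h2] using q.2⟩
  left_inv q := Subtype.ext (by change u * (u * q.1) = q.1; rw [← mul_assoc, ← sq, hu, one_mul])
  right_inv q := Subtype.ext (by change u * (u * q.1) = q.1; rw [← mul_assoc, ← sq, hu, one_mul])

theorem proj_deck (u : Circle × Circle) (hu : u ^ 2 = 1) (q : Cover) :
    proj (deck u hu q) = proj q := by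
  refine Subtype.ext ?_
  change (u * q.1) ^ 2 = q.1 ^ 2
  rw [mul_pow, hu, one_mul]

theorem exists_deck (y y' : Cover) (h : proj y = proj y') :
    ∃ h : Cover ≃ₜ Cover, (∀ z, proj (h z) = proj z) ∧ h y = y' := by
  have h' : y.1 ^ 2 = y'.1 ^ 2 := congrArg Subtype.val h
  refine ⟨deck (y'.1 * y.1⁻¹) (by rw [mul_pow, inv_pow, h', mul_inv_cancel]), proj_deck _ _, ?_⟩
  exact Subtype.ext (by change y'.1 * y.1⁻¹ * y.1 = _; rw [inv_mul_cancel_right])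

theorem isFiniteRegularCover_proj : IsFiniteRegularCover proj :=
  ⟨isCoveringMap_proj, proj_surjective, inferInstance, finite_proj_fibre, exists_deck⟩

/-- If `θ` lifts `δ` to the line then `2θ` lifts `γ` and grows by `2πk`, with `k` the winding
number. So `θ` grows by `πk`, and `δ` closes up exactly when `k` is even. -/
theorem winding_sq_even_iff {z z' x y : Circle} (δ : Path z z') (γ : Path x y) (hxy : x = y)
    (h : ∀ t, δ t ^ 2 = γ t) : Even (winding γ) ↔ z = z' := by
  obtain ⟨θ, hθ⟩ := exists_lift_exp δ
  have h2 (t) : Circle.exp (2 * θ t) = γ t := by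
    rw [← h, ← hθ, ← Circle.exp_nsmul, nsmul_eq_mul, Nat.cast_ofNat]
  have hw := winding_eq γ ⟨fun t => 2 * θ t, by fun_prop⟩ h2
  have h01 : Circle.exp (2 * θ 1) = Circle.exp (2 * θ 0) := by
    rw [h2, h2]; simp [hxy]
  obtain ⟨k, hk⟩ := Circle.exp_eq_exp.1 h01
  have hwk : winding γ = k := by
    rw [hw]
    change turns (2 * θ 1) - turns (2 * θ 0) = k
    rw [hk, turns_add]
    ring
  have hz : z = Circle.exp (θ 0) := by rw [hθ]; simp
  have hz' : z' = Circle.exp (θ 1) := by rw [hθ]; simp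
  rw [hwk, hz, hz', eq_comm, Circle.exp_eq_exp]
  constructor
  · rintro ⟨m, rfl⟩
    refine ⟨m, ?_⟩
    push_cast at hk
    linarith
  · rintro ⟨m, hm⟩
    refine ⟨m, ?_⟩
    have hpi := Real.pi_pos
    have : (k : ℝ) = m + m := mul_right_cancel₀ (b := 2 * Real.pi) (by positivity) (by linarith)
    exact_mod_cast this

theorem exists_lift_path (γ : C(unitInterval, Wedge)) (y : Cover) (h : γ 0 = proj y) :
    ∃ (y' : Cover) (δ : Path y y'), ∀ t, proj (δ t) = γ t := by
  obtain ⟨Γ, h1, h2⟩ := isCoveringMap_proj.exists_path_lifts γ y h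
  exact ⟨Γ 1, ⟨Γ, h2, rfl⟩, congrFun h1⟩

theorem even_windings_iff {y y' : Cover} {x : Wedge} (δ : Path y y') (γ : Path x x)
    (h : ∀ t, proj (δ t) = γ t) : (Even (windings γ).1 ∧ Even (windings γ).2) ↔ y = y' := by
  have h1 := winding_sq_even_iff (δ.map (f := fun q : Cover => q.1.1) (by fun_prop))
    (γ.map coordA.continuous) rfl fun t => congrArg (·.1.1) (h t)
  have h2 := winding_sq_even_iff (δ.map (f := fun q : Cover => q.1.2) (by fun_prop))
    (γ.map coordB.continuous) rfl fun t => congrArg (·.1.2) (h t)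
  rw [windings, h1, h2, Subtype.ext_iff, Prod.ext_iff]

theorem exists_lift_loop_iff {x : Wedge} (γ : Path x x) (y : Cover) (hy : proj y = x) :
    (∃ δ : Path y y, ∀ t, proj (δ t) = γ t) ↔ loopClass (ZMod 2) γ = 0 := by
  rw [loopClass_zmod_two_eq_zero_iff]
  constructor
  · rintro ⟨δ, h⟩
    exact (even_windings_iff δ γ h).2 rfl
  · intro he
    obtain ⟨y', δ, h⟩ := exists_lift_path γ y (by simp [hy])
    obtain rfl := (even_windings_iff δ γ h).1 he
    exact ⟨δ, h⟩

theorem isModTwoHomologyCover_proj : IsModTwoHomologyCover proj :=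
  ⟨isFiniteRegularCover_proj, fun y γ => exists_lift_loop_iff γ y rfl⟩

theorem exists_lift_commLoop (y : Cover) (hy : proj y = base) :
    ∃ γ : Path y y, ∀ t, proj (γ t) = commLoop t := by
  rw [exists_lift_loop_iff _ _ hy, loopClass_zmod_two_eq_zero_iff, windings_commLoop]
  simp

/-! ### Lifts of homotopy equivalences -/

theorem homotopic_congr {X : Type*} [TopologicalSpace X] {x y x' y' : X} {γ γ' : Path x y}
    {η η' : Path x' y'} (h : γ.Homotopic γ') (h1 : ∀ t, γ t = η t) (h2 : ∀ t, γ' t = η' t) :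
    η.Homotopic η' := by
  obtain rfl : x = x' := by simpa using h1 0
  obtain rfl : y = y' := by simpa using h1 1
  rwa [← show γ = η from Path.ext (funext h1), ← show γ' = η' from Path.ext (funext h2)]

theorem trans_congr {X : Type*} [TopologicalSpace X] {x y z x' y' z' : X} {γ : Path x y}
    {δ : Path y z} {γ' : Path x' y'} {δ' : Path y' z'} (h1 : ∀ t, γ t = γ' t)
    (h2 : ∀ t, δ t = δ' t) (t : unitInterval) : γ.trans δ t = γ'.trans δ' t := by
  obtain rfl : x = x' := by simpa using h1 0
  obtain rfl : y = y' := by simpa using h1 1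
  obtain rfl : z = z' := by simpa using h2 1
  rw [show γ = γ' from Path.ext (funext h1), show δ = δ' from Path.ext (funext h2)]

theorem map_trans_apply {X Y : Type*} [TopologicalSpace X] [TopologicalSpace Y] (f : C(X, Y))
    {x y z : X} (γ : Path x y) (δ : Path y z) (t : unitInterval) :
    f (γ.trans δ t) = (γ.map f.continuous).trans (δ.map f.continuous) t := by
  rw [← Path.map_trans]; rfl

theorem homotopic_of_proj {y y' : Cover} {δ δ' : Path y y'}
    (h : (δ.map proj.continuous).Homotopic (δ'.map proj.continuous)) : δ.Homotopic δ' :=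
  Path.Homotopic.Quotient.eq.1 (isCoveringMap_proj.injective_path_homotopic_map y y'
    (Path.Homotopic.Quotient.eq.2 h))

theorem path_eq_of_proj {y y' y'' : Cover} {δ : Path y y'} {δ' : Path y y''}
    (h : ∀ t, proj (δ t) = proj (δ' t)) (t : unitInterval) : δ t = δ' t :=
  congrFun (isCoveringMap_proj.eq_of_comp_eq δ.continuous δ'.continuous (funext h) 0 (by simp)) t

/-- Homotopic maps agree on the homology classes of loops. -/
theorem loopClass_map_eq_of_homotopic (R : Type) [CommRing R] {Y Z : Type} [TopologicalSpace Y]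
    [TopologicalSpace Z] {f g : C(Y, Z)} (h : f.Homotopic g) {y : Y} (γ : Path y y) :
    loopClass R (γ.map f.continuous) = loopClass R (γ.map g.continuous) := by
  obtain ⟨H⟩ := h
  have h := pathClass_eq_of_homotopic R (Path.Homotopic.map_trans_evalAt H γ)
  rw [pathClass_trans, pathClass_trans, add_comm] at h
  exact loopClass_eq_of_pathClass_eq R (add_left_cancel h)

/-! ### Finite generation, and invertibility of lifts on `H₁` -/

/-- The homomorphism from the fundamental group to the first homology. -/
def loopHom (R : Type) [CommRing R] {Y : Type} [TopologicalSpace Y] (y : Y) :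
    FundamentalGroup Y y →* Multiplicative (H1 R Y) where
  toFun := Quotient.lift (fun γ : Path y y => Multiplicative.ofAdd (loopClass R γ))
    fun _ _ h => congrArg _ (loopClass_eq_of_homotopic R h)
  map_one' := congrArg Multiplicative.ofAdd (loopClass_refl R y)
  map_mul' := by
    rintro ⟨γ⟩ ⟨γ'⟩
    exact congrArg Multiplicative.ofAdd ((loopClass_trans R γ' γ).trans (add_comm _ _))

theorem finite_H1_of_fg (R : Type) [CommRing R] {Y : Type} [TopologicalSpace Y]
    [PathConnectedSpace Y] (y : Y) [Group.FG (FundamentalGroup Y y)] : Module.Finite R (H1 R Y) := by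
  obtain ⟨S, hS⟩ := Group.FG.out (G := FundamentalGroup Y y)
  let T : Set (H1 R Y) := (fun g => (loopHom R y g).toAdd) '' S
  have hT : T.Finite := S.finite_toSet.image _
  refine ⟨⟨hT.toFinset, ?_⟩⟩
  rw [Set.Finite.coe_toFinset]
  rw [eq_top_iff, ← span_loopClass R y, Submodule.span_le]
  rintro _ ⟨γ, rfl⟩
  have key (g : FundamentalGroup Y y) : (loopHom R y g).toAdd ∈ Submodule.span R T := by
    have hg : g ∈ Subgroup.closure (S : Set (FundamentalGroup Y y)) := hS ▸ Subgroup.mem_top g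
    induction hg using Subgroup.closure_induction with
    | mem g hg => exact Submodule.subset_span ⟨g, hg, rfl⟩
    | one => rw [map_one]; exact Submodule.zero_mem _
    | mul g h _ _ hg hh => rw [map_mul]; exact Submodule.add_mem _ hg hh
    | inv g _ hg => rw [map_inv]; exact Submodule.neg_mem _ hg
  exact key (Path.Homotopic.Quotient.mk γ)

instance fg_fundamentalGroup_wedge (x : Wedge) : Group.FG (FundamentalGroup Wedge x) :=
  have : Group.FG (FundamentalGroup Wedge base) := Group.fg_of_surjective wedgeHom_surjective
  Group.fg_of_surjective (f := MulEquiv.toMonoidHom _)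
    (FundamentalGroup.fundamentalGroupMulEquivOfPathConnected base x).surjective

instance fg_fundamentalGroup_cover (y : Cover) : Group.FG (FundamentalGroup Cover y) := by
  let f := FundamentalGroup.map proj y
  have hf : Function.Injective f := isCoveringMap_proj.injective_path_homotopic_map y y
  have : Finite (proj ⁻¹' {proj y}) := finite_proj_fibre (proj y)
  -- A loop that acts trivially on the fibre lifts to a loop at `y`. The kernel of an action on a
  -- finite fibre has finite index, so `f.range` does too, and finite generation passes to it.
  have hle : (isCoveringMap_proj.monodromyPerm (proj y)).ker ≤ f.range := by
    intro g hg
    obtain ⟨γ, rfl⟩ := Path.Homotopic.Quotient.mk_surjective g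
    obtain ⟨y', δ, hδ⟩ := exists_lift_path γ y γ.source
    have hy' : proj y' = proj y := by simpa using hδ 1
    have h1 : isCoveringMap_proj.monodromy (.mk γ) ⟨y, rfl⟩ = ⟨y', hy'⟩ := by
      refine isCoveringMap_proj.monodromy_eq_of_map_eq (γ := .mk γ) (.mk δ) ?_
      exact congrArg Path.Homotopic.Quotient.mk (Path.ext (funext hδ))
    have h2 := DFunLike.congr_fun (MonoidHom.mem_ker.1 hg) ⟨y, rfl⟩
    obtain rfl : y' = y := congrArg Subtype.val (h1.symm.trans h2)
    exact ⟨.mk δ, congrArg Path.Homotopic.Quotient.mk (Path.ext (funext hδ))⟩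
  have : f.range.FiniteIndex := Subgroup.finiteIndex_of_le hle
  exact Group.fg_of_surjective (f := MulEquiv.toMonoidHom _) (MonoidHom.ofInjective hf).symm.surjective

instance : Module.Finite ℚ (H1 ℚ Cover) := finite_H1_of_fg ℚ ⟨(1, 1), .inl (one_pow 2)⟩

/-- The functor on fundamental groupoids induced by a homotopy equivalence is fully faithful. -/
def fullyFaithfulMap {X Y : Type} [TopologicalSpace X] [TopologicalSpace Y] (F : X ≃ₕ Y) :
    (FundamentalGroupoid.map F.toFun).FullyFaithful :=
  (FundamentalGroupoidFunctor.equivOfHomotopyEquiv F).fullyFaithfulFunctor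

theorem exists_homotopic_map {X Y : Type} [TopologicalSpace X] [TopologicalSpace Y] (F : X ≃ₕ Y)
    {x y : X} (δ : Path (F.toFun x) (F.toFun y)) :
    ∃ γ : Path x y, (γ.map F.toFun.continuous).Homotopic δ := by
  obtain ⟨γ, hγ⟩ := pathArrow_surjective ((fullyFaithfulMap F).preimage (pathArrow δ))
  refine ⟨γ, pathArrow_eq_iff.1 ?_⟩
  have := (fullyFaithfulMap F).map_preimage (pathArrow δ)
  rw [← hγ] at this
  exact this

/-- Project a loop `δ` at `G y` to the wedge and pull it back through `F` to a loop `β`. The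
homotopy inverse shows that `β` is trivial mod 2, so it lifts to a loop at `y`. The image of that
lift under `G` is homotopic to `δ`, because homotopies of projected paths lift. -/
theorem H1map_surjective_of_isLift (R : Type) [CommRing R] (F : Wedge ≃ₕ Wedge) (G : C(Cover, Cover))
    (hG : IsLift proj F.toFun G) : Function.Surjective (H1map R G) := by
  rw [← LinearMap.range_eq_top, eq_top_iff]
  let y : Cover := ⟨(1, 1), .inl (one_pow 2)⟩
  rw [← span_loopClass R (G y), Submodule.span_le]
  rintro _ ⟨δ, rfl⟩
  obtain ⟨β, hβ⟩ := exists_homotopic_map F ((δ.map proj.continuous).cast (hG y).symm (hG y).symm)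
  have h1 : loopClass (ZMod 2) (β.map F.toFun.continuous) = 0 := by
    rw [loopClass_eq_of_homotopic _ hβ]
    exact (exists_lift_loop_iff _ (G y) (hG y)).1 ⟨δ, fun _ => rfl⟩
  have h2 : loopClass (ZMod 2) β = 0 := by
    have h := loopClass_map_eq_of_homotopic (ZMod 2) F.left_inv β
    rw [← H1map_loopClass (ZMod 2) F.toFun] at h1
    have h3 := congrArg (H1map (ZMod 2) F.invFun) ((H1map_loopClass (ZMod 2) F.toFun β).symm.trans h1)
    rw [H1map_loopClass, map_zero] at h3
    exact h.symm.trans h3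
  obtain ⟨β', hβ'⟩ := (exists_lift_loop_iff β y rfl).2 h2
  refine ⟨loopClass R β', ?_⟩
  rw [H1map_loopClass]
  refine loopClass_eq_of_homotopic R (homotopic_of_proj (homotopic_congr hβ (fun t => ?_)
    fun t => rfl))
  exact (congrArg F.toFun (hβ' t)).symm.trans (hG (β' t)).symm

theorem H1map_bijective_of_isLift (F : Wedge ≃ₕ Wedge) (G : C(Cover, Cover))
    (hG : IsLift proj F.toFun G) : Function.Bijective (H1map ℚ G) :=
  have h := H1map_surjective_of_isLift ℚ F G hG
  ⟨LinearMap.injective_iff_surjective.2 h, h⟩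

/-! ### Finiteness of the orbit of the commutator class -/

/-- `F` need not fix `base`; conjugating by a spoke makes the map it induces an automorphism `φ` of
`π₁` at `base`, to which rigidity applies. The path `τ` combines this spoke with the conjugating
loop. -/
theorem exists_conj_map_commLoop (F : Wedge ≃ₕ Wedge) : ∃ τ : Path (F.toFun base) base,
    (commLoop.map F.toFun.continuous).Homotopic ((τ.trans commLoop).trans τ.symm) ∨
    (commLoop.map F.toFun.continuous).Homotopic ((τ.trans commLoop.symm).trans τ.symm) := by
  let P := pathArrow (spoke (F.toFun base))
  let α := (Groupoid.isoEquivHom _ _).symm (Groupoid.inv P)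
  let φ : FundamentalGroup Wedge base ≃* FundamentalGroup Wedge base :=
    ((fullyFaithfulMap F).mulEquivEnd (.mk base)).trans α.conj
  let A := pathArrow (commLoop.map F.toFun.continuous)
  have hφ : φ (cls commLoop) = (P ≫ A ≫ Groupoid.inv P : FundamentalGroup Wedge base) := by
    change α.inv ≫ A ≫ α.hom = _
    simp [α, Groupoid.isoEquivHom, Groupoid.inv_eq_inv]
  have key (D : Path base base) (h : IsConj (φ (cls commLoop)) (cls D)) :
      ∃ τ : Path (F.toFun base) base,
        (commLoop.map F.toFun.continuous).Homotopic ((τ.trans D).trans τ.symm) := by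
    obtain ⟨g, hg⟩ := isConj_iff.1 h
    obtain ⟨σ, rfl⟩ := cls_surjective g
    refine ⟨(spoke (F.toFun base)).symm.trans σ, pathArrow_eq_iff.1 ?_⟩
    rw [hφ, mul_inv_eq_iff_eq_mul, End.mul_def, End.mul_def] at hg
    have hg' : (P ≫ A ≫ Groupoid.inv P) ≫ pathArrow σ = pathArrow σ ≫ pathArrow D := hg
    simp only [pathArrow_trans, pathArrow_symm]
    change A = ((Groupoid.inv P ≫ _) ≫ _) ≫ Groupoid.inv (Groupoid.inv P ≫ _)
    rw [Category.assoc (Groupoid.inv P), ← hg']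
    simp [Groupoid.inv_eq_inv]
  rcases isConjOrInv_map_commLoop φ with h | h
  · obtain ⟨τ, hτ⟩ := key _ h
    exact ⟨τ, .inl hτ⟩
  · obtain ⟨τ, hτ⟩ := key commLoop.symm h
    exact ⟨τ, .inr hτ⟩

/-- The set of the homology classes of the lifts of the commutator and of their inverses. -/
def commClasses : Set (H1 ℚ Cover) :=
  {v | ∃ (y : Cover) (γ : Path y y), (∀ t, proj (γ t) = commLoop t) ∧
    (v = loopClass ℚ γ ∨ v = -loopClass ℚ γ)}

/-- A lift of the commutator is determined by its starting point, and the fibre is finite. -/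
theorem finite_commClasses : commClasses.Finite := by
  have h (y : proj ⁻¹' {base}) := exists_lift_commLoop y.1 y.2
  choose γ hγ using h
  have : Finite (proj ⁻¹' {base}) := finite_proj_fibre base
  refine ((Set.finite_range fun y => loopClass ℚ (γ y)).union
    (Set.finite_range fun y => -loopClass ℚ (γ y))).subset ?_
  rintro v ⟨y, δ, hδ, hv⟩
  have hy : proj y = base := by simpa using hδ 0
  have h : loopClass ℚ δ = loopClass ℚ (γ ⟨y, hy⟩) := loopClass_congr ℚ
    (path_eq_of_proj fun t => (hδ t).trans (hγ ⟨y, hy⟩ t).symm)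
  rw [h] at hv
  exact hv.imp (fun h => ⟨_, h.symm⟩) fun h => ⟨_, h.symm⟩

theorem H1map_mem_commClasses (F : Wedge ≃ₕ Wedge) (G : C(Cover, Cover))
    (hG : IsLift proj F.toFun G) {v : H1 ℚ Cover} (hv : v ∈ commClasses) :
    H1map ℚ G v ∈ commClasses := by
  have key {y : Cover} {γ : Path y y} (hγ : ∀ t, proj (γ t) = commLoop t) :
      H1map ℚ G (loopClass ℚ γ) ∈ commClasses := by
    have hy : proj y = base := by simpa using hγ 0
    have hGy : proj (G y) = F.toFun base := by rw [hG y, hy]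
    obtain ⟨τ, hτ⟩ := exists_conj_map_commLoop F
    -- The lift of `τ` ends over `base`, at the point where the new lift of the commutator starts;
    -- conjugation by it is invisible in homology.
    obtain ⟨y', τ', hτ'⟩ := exists_lift_path τ (G y) (by simp [hGy])
    have hy' : proj y' = base := by simpa using hτ' 1
    obtain ⟨γ', hγ'⟩ := exists_lift_commLoop y' hy'
    have hom {δ : Path base base} {δ' : Path y' y'} (hδ : ∀ t, proj (δ' t) = δ t)
        (h : (commLoop.map F.toFun.continuous).Homotopic ((τ.trans δ).trans τ.symm)) :
        loopClass ℚ (γ.map G.continuous) = loopClass ℚ δ' := by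
      rw [← loopClass_conj ℚ τ' δ']
      refine loopClass_eq_of_homotopic ℚ (homotopic_of_proj (homotopic_congr h (fun t => ?_)
        fun t => ?_))
      · exact (congrArg F.toFun (hγ t)).symm.trans (hG (γ t)).symm
      · rw [Path.map_trans, Path.map_trans]
        exact trans_congr (trans_congr (fun t => (hτ' t).symm) fun t => (hδ t).symm)
          (fun t => (hτ' _).symm) t
    rw [H1map_loopClass]
    refine ⟨y', γ', hγ', hτ.imp (fun h => hom hγ' h) fun h => ?_⟩
    rw [← loopClass_symm]
    exact hom (fun t => hγ' _) h
  obtain ⟨y, γ, hγ, rfl | rfl⟩ := hv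
  · exact key hγ
  · obtain ⟨y', γ', hγ', h⟩ := key hγ
    refine ⟨y', γ', hγ', ?_⟩
    rw [map_neg]
    rcases h with h | h
    · exact .inr (by rw [h])
    · exact .inl (by rw [h, neg_neg])

theorem finite_liftOrbit {v : H1 ℚ Cover} (hv : v ∈ commClasses) : (liftOrbit proj v).Finite :=
  finite_commClasses.subset fun _ ⟨F, G, hG, h⟩ => h ▸ H1map_mem_commClasses F G hG hv

/-- An injective self-map of a finite set is onto, so the inverse also preserves `S`; this covers
negative powers. -/
theorem zpow_apply_mem_of_finite {R M : Type*} [Semiring R] [AddCommMonoid M] [Module R M]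
    (e : M ≃ₗ[R] M) {S : Set M} (hS : S.Finite) (he : ∀ v ∈ S, e v ∈ S) (d : ℤ) {v : M}
    (hv : v ∈ S) : (e ^ d) v ∈ S := by
  have hsymm : ∀ v ∈ S, e⁻¹ v ∈ S := by
    intro v hv
    have : Finite S := hS
    obtain ⟨⟨w, hw⟩, h⟩ := Finite.surjective_of_injective (f := fun v : S => (⟨e v, he v v.2⟩ : S))
      (fun a b h => Subtype.ext (e.injective (congrArg Subtype.val h))) ⟨v, hv⟩
    obtain rfl : e w = v := congrArg Subtype.val h
    have : e⁻¹ (e w) = w := e.symm_apply_apply w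
    rwa [this]
  induction d using Int.induction_on with
  | zero => simpa using hv
  | succ d ih => rw [add_comm, zpow_add, zpow_one]; exact he _ ih
  | pred d ih => rw [sub_eq_neg_add, zpow_add, zpow_neg_one]; exact hsymm _ ih

/-! ### The class of the lifted commutator does not vanish -/

section CommutatorClass

open Classical in
/-- The map that wraps the edge of the cover from `(1, 1)` to `(-1, 1)` around the circle and
collapses the other edges. -/
def edgeMap : C(Cover, Circle) where
  toFun q := if q.1.2 = 1 ∧ 0 ≤ (q.1.1 : ℂ).im then q.1.1 ^ 2 else 1
  continuous_toFun := by
    refine continuous_if (fun q hq => ?_) (by fun_prop) (by fun_prop)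
    have hcl : IsClosed (Set.ofPred fun q : Cover => q.1.2 = 1 ∧ 0 ≤ (q.1.1 : ℂ).im) :=
      (isClosed_eq (f := fun q : Cover => q.1.2) (by fun_prop) continuous_const).inter
        (isClosed_le (g := fun q : Cover => (q.1.1 : ℂ).im) continuous_const (by fun_prop))
    have hop : IsOpen (Set.ofPred fun q : Cover => 0 < (q.1.2 : ℂ).re ∧ 0 < (q.1.1 : ℂ).im) :=
      (isOpen_lt (g := fun q : Cover => (q.1.2 : ℂ).re) continuous_const (by fun_prop)).inter
        (isOpen_lt (g := fun q : Cover => (q.1.1 : ℂ).im) continuous_const (by fun_prop))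
    obtain ⟨h1, h2⟩ := hcl.frontier_subset hq
    have h3 : ¬ 0 < (q.1.1 : ℂ).im := by
      intro h
      -- Off the real axis in `z`, the condition defining the cover forces `w = ±1`, and positive
      -- real part selects `w = 1`. So frontier points have real `z`, where `z ^ 2 = 1` and both
      -- branches agree.
      refine hq.2 (interior_maximal (fun q' hq' => ?_) hop ⟨by simp [h1], h⟩)
      obtain ⟨h4, h5⟩ := hq'
      refine ⟨?_, h5.le⟩
      rcases q'.2 with h6 | h6
      · rcases circle_sq_eq_sq (h6.trans (one_pow 2).symm) with h7 | h7 <;> simp [h7] at h5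
      · refine (circle_sq_eq_sq (h6.trans (one_pow 2).symm)).resolve_right fun h7 => ?_
        simp [h7] at h4
        linarith
    have h4 : (q.1.1 : ℂ).im = 0 := le_antisymm (not_lt.1 h3) h2
    by_contra h5
    refine im_ne_zero_of_ne (z := q.1.1) (fun h => h5 (by simp [h])) (fun h => h5 (by simp [h])) h4

open Classical in
theorem edgeMap_eq_one {q : Cover} (h : q.1.1 ^ 2 = 1) : edgeMap q = 1 :=
  (ite_congr rfl (fun _ => h) fun _ => rfl).trans (ite_self _)

/-- Half of the circle. -/
def halfCircle : Path (1 : Circle) (-1) where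
  toFun t := Circle.exp (Real.pi * t)
  continuous_toFun := by fun_prop
  source' := by simp
  target' := Circle.ext (by simp [Circle.coe_exp])

theorem halfCircle_im_nonneg (t : unitInterval) : 0 ≤ (halfCircle t : ℂ).im := by
  change 0 ≤ (Circle.exp (Real.pi * t) : ℂ).im
  rw [Circle.coe_exp, Complex.exp_ofReal_mul_I_im]
  exact Real.sin_nonneg_of_nonneg_of_le_pi (by have := t.2.1; positivity)
    (by nlinarith [Real.pi_pos, t.2.2])

theorem halfCircle_sq (t : unitInterval) : halfCircle t ^ 2 = Circle.exp (2 * Real.pi * t) := by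
  change Circle.exp (Real.pi * t) ^ 2 = _
  rw [← Circle.exp_nsmul, nsmul_eq_mul, Nat.cast_ofNat, mul_assoc]

/-- A horizontal path in the cover. -/
def edgeA {z z' : Circle} (δ : Path z z') (w : Circle) (hw : w ^ 2 = 1) :
    Path (⟨(z, w), .inr hw⟩ : Cover) ⟨(z', w), .inr hw⟩ :=
  δ.map (f := fun z => (⟨(z, w), .inr hw⟩ : Cover)) (by fun_prop)

/-- A vertical path in the cover. -/
def edgeB {w w' : Circle} (δ : Path w w') (z : Circle) (hz : z ^ 2 = 1) :
    Path (⟨(z, w), .inl hz⟩ : Cover) ⟨(z, w'), .inl hz⟩ :=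
  δ.map (f := fun w => (⟨(z, w), .inl hz⟩ : Cover)) (by fun_prop)

theorem neg_one_sq_circle : (-1 : Circle) ^ 2 = 1 := Circle.ext (by simp)

/-- The lift of the commutator at `(1, 1)`. -/
def squareLoop : Path (⟨(1, 1), .inr (one_pow 2)⟩ : Cover) ⟨(1, 1), .inr (one_pow 2)⟩ :=
  (((edgeA halfCircle 1 (one_pow 2)).trans (edgeB halfCircle (-1) neg_one_sq_circle)).trans
    (edgeA halfCircle.symm (-1) neg_one_sq_circle)).trans (edgeB halfCircle.symm 1 (one_pow 2))

theorem proj_squareLoop (t : unitInterval) : proj (squareLoop t) = commLoop t := by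
  rw [squareLoop, map_trans_apply, Path.map_trans, Path.map_trans, commLoop]
  refine trans_congr (trans_congr (trans_congr ?_ ?_) ?_) ?_ t
  · exact fun t => Subtype.ext (Prod.ext (halfCircle_sq t) (one_pow 2))
  · exact fun t => Subtype.ext (Prod.ext neg_one_sq_circle (halfCircle_sq t))
  · exact fun t => Subtype.ext (Prod.ext (halfCircle_sq _) neg_one_sq_circle)
  · exact fun t => Subtype.ext (Prod.ext (one_pow 2) (halfCircle_sq _))

theorem winding_edgeMap_squareLoop : winding (squareLoop.map edgeMap.continuous) = 1 := by
  have hne : (-1 : Circle) ≠ 1 := fun h => by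
    have := congrArg (fun z : Circle => (z : ℂ).re) h
    norm_num at this
  have h1 (t) : edgeMap (edgeA halfCircle 1 (one_pow 2) t) = Circle.exp (2 * Real.pi * t) :=
    (if_pos ⟨rfl, halfCircle_im_nonneg t⟩).trans (halfCircle_sq t)
  have h3 (t) : edgeMap (edgeA halfCircle.symm (-1) neg_one_sq_circle t) = 1 :=
    if_neg fun h => hne h.1
  have h2 (t) (z : Circle) (hz : z ^ 2 = 1) {w w' : Circle} (δ : Path w w') :
      edgeMap (edgeB δ z hz t) = 1 := edgeMap_eq_one hz
  have hc {x y : Circle} (γ : Path x y) (h : ∀ t, γ t = 1) : winding γ = 0 :=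
    winding_const γ fun t => by rw [h, ← γ.source, h]
  rw [squareLoop, Path.map_trans, Path.map_trans, Path.map_trans, winding_trans, winding_trans,
    winding_trans, winding_exp _ h1, hc _ fun t => h2 t _ _ _, hc _ h3, hc _ fun t => h2 t _ _ _]
  rfl

/-- A deck transformation moves the starting point to `(1, 1)`, and unique lifting identifies the
result with `squareLoop`, whose image under `edgeMap` has winding number one. -/
theorem loopClass_ne_zero {y : Cover} (γ : Path y y) (hγ : ∀ t, proj (γ t) = commLoop t) :
    loopClass ℚ γ ≠ 0 := by
  intro h
  have hy : proj y = base := by simpa using hγ 0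
  obtain ⟨d, hd, hdy⟩ := exists_deck y ⟨(1, 1), .inr (one_pow 2)⟩
    (hy.trans (by rw [← squareLoop.source, proj_squareLoop]; simp))
  have h1 : loopClass ℚ squareLoop = 0 := by
    have h2 := congrArg (H1map ℚ (d : C(Cover, Cover))) h
    rw [H1map_loopClass, map_zero] at h2
    rw [← h2]
    refine loopClass_congr ℚ (path_eq_of_proj (δ' := (γ.map d.continuous).cast hdy.symm rfl) ?_)
    exact fun t => (proj_squareLoop t).trans ((hd (γ t)).trans (hγ t)).symm
  have h3 := winding_eq_zero_of_loopClass ℚ edgeMap squareLoop h1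
  rw [winding_edgeMap_squareLoop] at h3
  norm_num at h3

end CommutatorClass

end RankTwo

end

theorem mainTheorem2 :
    -- `π₁` of the wedge is free of rank 2 on `a`, `b`
    (∃ e : FreeGroup (Fin 2) ≃* FundamentalGroup RankTwo.Wedge RankTwo.base,
      e (FreeGroup.of 0) = RankTwo.cls RankTwo.loopA ∧
      e (FreeGroup.of 1) = RankTwo.cls RankTwo.loopB) ∧
    -- the cover is the (finite, regular) mod-2 homology cover of the wedge
    RankTwo.IsModTwoHomologyCover RankTwo.proj ∧
    -- automorphisms preserve the conjugacy class of `[a, b]` up to inversion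
    (∀ φ : FundamentalGroup RankTwo.Wedge RankTwo.base ≃*
        FundamentalGroup RankTwo.Wedge RankTwo.base,
      IsConj (φ (RankTwo.cls RankTwo.commLoop)) (RankTwo.cls RankTwo.commLoop) ∨
      IsConj (φ (RankTwo.cls RankTwo.commLoop)) (RankTwo.cls RankTwo.commLoop)⁻¹) ∧
    -- at each point over the base point, `[a, b]` lifts to a loop
    (∀ y : RankTwo.Cover, RankTwo.proj y = RankTwo.base →
      ∃ γ : Path y y, ∀ t, RankTwo.proj (γ t) = RankTwo.commLoop t) ∧
    -- the class `v` of any such lift is nonzero and has finite orbit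
    (∀ (y : RankTwo.Cover) (γ : Path y y), (∀ t, RankTwo.proj (γ t) = RankTwo.commLoop t) →
      RankTwo.loopClass ℚ γ ≠ 0 ∧
      (RankTwo.liftOrbit RankTwo.proj (RankTwo.loopClass ℚ γ)).Finite ∧
      -- in particular no single lift `G` has infinitely many iterates `G_* ^ d (v)`, `d ∈ ℤ`
      ∀ (F : ContinuousMap.HomotopyEquiv RankTwo.Wedge RankTwo.Wedge)
        (G : C(RankTwo.Cover, RankTwo.Cover)), RankTwo.IsLift RankTwo.proj F.toFun G →
        ∃ e : RankTwo.H1 ℚ RankTwo.Cover ≃ₗ[ℚ] RankTwo.H1 ℚ RankTwo.Cover,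
          (∀ w, e w = RankTwo.H1map ℚ G w) ∧
          (Set.range fun d : ℤ => (e ^ d) (RankTwo.loopClass ℚ γ)).Finite) := by
  refine ⟨⟨RankTwo.wedgeEquiv, RankTwo.wedgeHom_of_zero, RankTwo.wedgeHom_of_one⟩,
    RankTwo.isModTwoHomologyCover_proj, RankTwo.isConjOrInv_map_commLoop,
    RankTwo.exists_lift_commLoop, fun y γ hγ => ?_⟩
  have hv : RankTwo.loopClass ℚ γ ∈ RankTwo.commClasses := ⟨y, γ, hγ, .inl rfl⟩
  refine ⟨RankTwo.loopClass_ne_zero γ hγ, RankTwo.finite_liftOrbit hv, fun F G hG => ?_⟩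
  let e := LinearEquiv.ofBijective _ (RankTwo.H1map_bijective_of_isLift F G hG)
  refine ⟨e, fun w => rfl, RankTwo.finite_commClasses.subset ?_⟩
  rintro _ ⟨d, rfl⟩
  exact RankTwo.zpow_apply_mem_of_finite e RankTwo.finite_commClasses
    (fun v hv => RankTwo.H1map_mem_commClasses F G hG hv) d hv
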